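/- Let $\mathbb S^2\subset\mathbb R^3$ be the unit sphere with poles $(0,0,\pm1)$; for $w\in\mathbb S^2$ and $t\in(-1,1)$ let $C(w,t)=\{x\in\mathbb S^2:\langle x,w\rangle\ge t\}$, with boundary circle $\partial C(w,t)$ in $\mathbb S^2$. Let $\Gamma$ be the HEALPix projection of $\mathbb S^2$ without the poles to $[0,2)\times(-\frac12,\frac12)$: for $x=(\cos\phi\sin\theta,\sin\phi\sin\theta,\cos\theta)$ with $\phi\in[0,2\pi)$, $\theta\in(0,\pi)$, put $z=\cos\theta$ and $$\Gamma(x)=\Big(\frac{\phi}{\pi},\ \frac38 z\Big)\quad\text{if }|z|\le\tfrac23,$$ $$\Gamma(x)=\Big(\frac1\pi\Big[\phi-\big(1-\sqrt{3(1-|z|)}\big)\big((\phi \bmod \tfrac{\pi}{2})-\tfrac{\pi}{4}\big)\Big],\ \frac{\operatorname{sgn}(z)}{4}\big(2-\sqrt{3(1-|z|)}\big)\Big)\quad\text{if }|z|>\tfrac23 .$$ A continuous curve $\beta:[a,b]\to\mathbb R^2$, $a<b$, is called $n$-convex if there are $a=t_0<t_1<\dots<t_n=b$ and convex sets $A_1,\dots,A_n\subset\mathbb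 R^2$ with $\beta([t_{j-1},t_j])\subset\partial A_j$ for $1\le j\le n$. Then there is a constant $M$ such that for every $(w,t)\in\mathbb S^2\times(-1,1)$ the projected boundary $\Gamma(\partial C(w,t))$ consists of at most $M$ pieces, each of which is at most $36$-convex. Precisely: cut the circle $\partial C(w,t)$ at the poles lying on it and at the points where the restriction of $\Gamma$ to it is discontinuous (if there is no such point, cut it at one suitable point). Then there are at least one and at most $M$ cut points, and on each of the resulting open arcs $\Gamma$ is continuous and extends continuously to the end points of the arc, and the resulting curve, parametrized over a compact interval, is $n$-convex for some $n\le 36$. -/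

import Mathlib

/-- Ambient Euclidean space of the unit sphere `S²`. -/
abbrev E3 : Type := EuclideanSpace ℝ (Fin 3)

/-- The unit sphere `S²`. -/
abbrev S2 : Type := Metric.sphere (0 : E3) 1

/-- The spherical cap `C(w,t) = {x ∈ S² : ⟨x,w⟩ ≥ t}`. -/
def sphericalCap (w : S2) (t : ℝ) : Set S2 :=
  {x | t ≤ inner ℝ (x : E3) (w : E3)}

/-- The boundary `∂C(w,t)` of the cap, relative to the sphere. -/
def capBoundary (w : S2) (t : ℝ) : Set S2 :=
  frontier (sphericalCap w t)

/-- The two poles `(0,0,±1)` of the sphere, where the projection is not defined. -/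
def poles : Set S2 := {x | (x : E3) 0 = 0 ∧ (x : E3) 1 = 0}

/-- The longitude `φ ∈ [0,2π)` of a point
`(cos φ sin θ, sin φ sin θ, cos θ)` of the sphere (only used off the poles). -/
noncomputable def longitude (x : S2) : ℝ :=
  if 0 ≤ Complex.arg ⟨(x : E3) 0, (x : E3) 1⟩ then Complex.arg ⟨(x : E3) 0, (x : E3) 1⟩
  else Complex.arg ⟨(x : E3) 0, (x : E3) 1⟩ + 2 * Real.pi

/-- The residue `φ mod π/2 ∈ [0,π/2)`. -/
noncomputable def modHalfPi (φ : ℝ) : ℝ :=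
  φ - Real.pi / 2 * (⌊φ / (Real.pi / 2)⌋ : ℝ)

/-- The HEALPix projection `Γ` of the sphere (without its poles) to the plane,
written with `z = cos θ` and the longitude `φ`. -/
noncomputable def healpixProj (x : S2) : ℝ × ℝ :=
  let φ := longitude x
  let z := (x : E3) 2
  if |z| ≤ 2 / 3 then
    (φ / Real.pi, 3 / 8 * z)
  else if 2 / 3 < z then
    (1 / Real.pi * (φ - (1 - √(1 - z) * √3) * (modHalfPi φ - Real.pi / 4)),
      1 / Real.pi * (Real.pi / 4 * (2 - √(1 - z) * √3)))
  else
    (1 / Real.pi * (φ - (1 - √(1 - |z|) * √3) * (modHalfPi φ - Real.pi / 4)),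
      1 / Real.pi * (Real.pi / 4 * (√(1 - |z|) * √3 - 2)))

/-- `β : [a,b] → ℝ²` is an `n`-convex curve: it is continuous, and `[a,b]` can be divided
into `n` consecutive intervals, each of which `β` maps into the boundary of a convex set.
(Convexity and boundary do not depend on the norm of the plane.) -/
def IsNConvex (n : ℕ) (a b : ℝ) (β : ℝ → ℝ × ℝ) : Prop :=
  a < b ∧ ContinuousOn β (Set.Icc a b) ∧
    ∃ τ : Fin (n + 1) → ℝ, StrictMono τ ∧ τ 0 = a ∧ τ (Fin.last n) = b ∧
      ∀ j : Fin n, ∃ A : Set (ℝ × ℝ), Convex ℝ A ∧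
        β '' Set.Icc (τ j.castSucc) (τ j.succ) ⊆ frontier A

/-- The points at which the curve `Γ(∂C(w,t))` breaks: the poles on `∂C(w,t)`, where `Γ` is
undefined, and the points at which the restriction of `Γ` to `∂C(w,t)` is discontinuous. -/
def breakPoints (w : S2) (t : ℝ) : Set S2 :=
  {x ∈ capBoundary w t |
    x ∈ poles ∨ ¬ ContinuousWithinAt healpixProj (capBoundary w t \ poles) x}

/-! Write `w = (p u, p v, q)` with `(u, v)` a unit vector and `p ≥ 0`, and parametrize the circle by
an angle `r`, so that its height is `z = t q + ρ p cos r` with `ρ² = 1 - t²`. If `p > 0`, the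
longitude at height `z` is, up to an additive constant and a sign distinguishing the two halves of
the circle, the function `azimuth`. In the equatorial belt the image is therefore an affine image of
the graph of `azimuth` over `z`. In a polar region put `s = √(3(1 - |z|))`: as long as the longitude
stays in one quadrant, `φ mod π/2` is `φ` minus a constant, and the image is an affine image of the
graph of `s * azimuth (1 - s²/3)` over `s` (with `q` replaced by `-q` in the south). A graph of a
convex or concave function lies in the boundary of a convex set, its epigraph or hypograph.

The second derivatives of these functions are nonnegative factors times `equatorialInflection` and
`polarInflection`, polynomials of degree at most 4 in `z`, hence trigonometric polynomials of degree
at most 4 in `r`. A nonzero trigonometric polynomial of degree `n` has at most `2n` zeros per period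
(`IsTrigPoly.encard_roots_le`). Collect the zeros of the three inflection functions, of `sin r`
(height monotone), of the coordinates `x`, `y` (quadrant fixed) and of `z ∓ 2/3` (region fixed),
omitting functions that vanish identically. There are at most 34 of them per period, and on each gap
between them the image is convex (`isConvexGap_of_pos`, or `isConvexGap_of_parallel` when `p = 0`).
Since `Γ` along the circle is continuous inside the gaps, breaks occur only at these parameters.
Cutting at the breaks and counting gaps bounds both the number of pieces and their convexity order
(`exists_nConvex_pieces`). -/

/-! ### Azimuth and its derivatives. -/

/-- Up to the factor `p²`, the squared distance of the circle at height `z` from its axis plane. -/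
noncomputable def capDisc (p q t z : ℝ) : ℝ := p ^ 2 - t ^ 2 + 2 * t * q * z - z ^ 2

/-- The longitude, relative to its centre, of the point at height `z` on the boundary of a cap. -/
noncomputable def azimuth (p q t z : ℝ) : ℝ :=
  Real.arccos ((t - q * z) / (p * √(1 - z ^ 2)))

/-- The polynomial that governs the sign of the second derivative of `azimuth`. -/
noncomputable def equatorialInflection (p q t z : ℝ) : ℝ :=
  -t * (1 - z ^ 2) * capDisc p q t z +
    (q - t * z) * (2 * z * capDisc p q t z - (1 - z ^ 2) * (t * q - z))

/-- The polynomial that governs the sign of the second derivative of `s ↦ s * azimuth (1 - s²/3)`. -/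
noncomputable def polarInflection (p q t z : ℝ) : ℝ :=
  -(q - t * z) * (1 + z) * capDisc p q t z + 2 / 3 * equatorialInflection p q t z

/-- Since `p² + q² = 1`, one has `p²(1 - z²) - (t - qz)² = capDisc p q t z`. Its positivity keeps
the argument of `arccos` away from `±1` and evaluates the square root in the chain rule. -/
theorem hasDerivAt_azimuth {p q t z : ℝ} (hp : 0 < p) (hpq : p ^ 2 + q ^ 2 = 1)
    (hz : z ^ 2 < 1) (hD : 0 < capDisc p q t z) :
    HasDerivAt (azimuth p q t) ((q - t * z) / ((1 - z ^ 2) * √(capDisc p q t z))) z := by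
  have hz' : 0 < 1 - z ^ 2 := by linarith
  have hs : 0 < √(1 - z ^ 2) := Real.sqrt_pos.2 hz'
  have hss : √(1 - z ^ 2) ^ 2 = 1 - z ^ 2 := Real.sq_sqrt hz'.le
  have hd : 0 < √(capDisc p q t z) := Real.sqrt_pos.2 hD
  have hdd : √(capDisc p q t z) ^ 2 = capDisc p q t z := Real.sq_sqrt hD.le
  set s := √(1 - z ^ 2) with hs_def
  set d := √(capDisc p q t z) with hd_def
  have key : 1 - ((t - q * z) / (p * s)) ^ 2 = (d / (p * s)) ^ 2 := by
    have : (p * s) ^ 2 - (t - q * z) ^ 2 = d ^ 2 := by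
      rw [hdd, mul_pow, hss, capDisc]
      linear_combination (-z ^ 2) * hpq
    field_simp
    linear_combination this
  have hpos : 0 < (d / (p * s)) ^ 2 := by positivity
  have h1 : (t - q * z) / (p * s) ≠ -1 := by
    intro h; rw [h] at key; norm_num at key; rw [← key] at hpos; exact lt_irrefl _ hpos
  have h2 : (t - q * z) / (p * s) ≠ 1 := by
    intro h; rw [h] at key; norm_num at key; rw [← key] at hpos; exact lt_irrefl _ hpos
  have hsd : HasDerivAt (fun z : ℝ => √(1 - z ^ 2)) (-(z / s)) z := by
    have h0 : HasDerivAt (fun z : ℝ => 1 - z ^ 2) (-(2 * z)) z := by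
      simpa using ((hasDerivAt_id z).pow 2).const_sub 1
    have := h0.sqrt hz'.ne'
    convert this using 1
    rw [← hs_def]; field_simp
  have hnum : HasDerivAt (fun z : ℝ => t - q * z) (-q) z := by
    simpa using ((hasDerivAt_id z).const_mul q).const_sub t
  have hg := hnum.div (hsd.const_mul p) (by rw [← hs_def]; positivity)
  have hA := (Real.hasDerivAt_arccos h1 h2).comp z hg
  have e : √(1 - ((t - q * z) / (p * s)) ^ 2) = d / (p * s) := by
    rw [key, Real.sqrt_sq (by positivity)]
  refine hA.congr_deriv ?_
  rw [e, ← hs_def, ← hss]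
  field_simp
  linear_combination q * hss

theorem hasDerivAt_azimuth_deriv {p q t z : ℝ} (hz : z ^ 2 < 1) (hD : 0 < capDisc p q t z) :
    HasDerivAt (fun z => (q - t * z) / ((1 - z ^ 2) * √(capDisc p q t z)))
      (equatorialInflection p q t z /
        ((1 - z ^ 2) ^ 2 * (capDisc p q t z * √(capDisc p q t z)))) z := by
  have hz' : 0 < 1 - z ^ 2 := by linarith
  have hd : 0 < √(capDisc p q t z) := Real.sqrt_pos.2 hD
  have hdd : √(capDisc p q t z) ^ 2 = capDisc p q t z := Real.sq_sqrt hD.le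
  have h0 : HasDerivAt (fun z : ℝ => 1 - z ^ 2) (-(2 * z)) z := by
    simpa using ((hasDerivAt_id z).pow 2).const_sub 1
  have h1 : HasDerivAt (capDisc p q t) (2 * t * q - 2 * z) z := by
    have a := (((hasDerivAt_id z).const_mul (2 * t * q)).const_add (p ^ 2 - t ^ 2)).sub
      ((hasDerivAt_id z).pow 2)
    refine (a.congr_deriv (by simp)).congr_of_eventuallyEq (Filter.Eventually.of_forall fun x => ?_)
    simp [capDisc]
  have hnum : HasDerivAt (fun z : ℝ => q - t * z) (-t) z := by
    simpa using ((hasDerivAt_id z).const_mul t).const_sub q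
  have h := hnum.div (h0.mul (h1.sqrt hD.ne')) (mul_pos hz' hd).ne'
  refine h.congr_deriv ?_
  rw [equatorialInflection]
  set d := √(capDisc p q t z) with hd_def
  rw [← hdd]
  simp only [Pi.mul_apply, ← hd_def]
  field_simp
  ring

theorem hasDerivAt_polar {p q t s z : ℝ} (hp : 0 < p) (hpq : p ^ 2 + q ^ 2 = 1)
    (hsz : 1 - s ^ 2 / 3 = z) (hz : z ^ 2 < 1) (hD : 0 < capDisc p q t z) :
    HasDerivAt (fun s => s * azimuth p q t (1 - s ^ 2 / 3))
      (azimuth p q t (1 - s ^ 2 / 3) - 2 * s ^ 2 / 3 * ((q - t * (1 - s ^ 2 / 3)) /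
        ((1 - (1 - s ^ 2 / 3) ^ 2) * √(capDisc p q t (1 - s ^ 2 / 3))))) s := by
  subst hsz
  have h0 : HasDerivAt (fun s : ℝ => 1 - s ^ 2 / 3) (-(2 * s / 3)) s := by
    simpa using (((hasDerivAt_id s).pow 2).div_const 3).const_sub 1
  have h := (hasDerivAt_id s).mul ((hasDerivAt_azimuth hp hpq hz hD).comp s h0)
  refine h.congr_deriv ?_
  simp only [Function.comp, id]
  ring

/-- With `A` the azimuth and `s² = 3(1 - z)`, the second derivative is `-2s A' + (4s³/9) A'' = 2s
(-A' + (2/3)(1 - z) A'')`. Over a common denominator the bracket gives `polarInflection`. -/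
theorem hasDerivAt_polar_deriv {p q t s z : ℝ} (hp : 0 < p) (hpq : p ^ 2 + q ^ 2 = 1)
    (hsz : 1 - s ^ 2 / 3 = z) (hz : z ^ 2 < 1) (hD : 0 < capDisc p q t z) :
    HasDerivAt (fun s => azimuth p q t (1 - s ^ 2 / 3) -
        2 * s ^ 2 / 3 * ((q - t * (1 - s ^ 2 / 3)) /
          ((1 - (1 - s ^ 2 / 3) ^ 2) * √(capDisc p q t (1 - s ^ 2 / 3)))))
      (2 * s * (1 - z) / ((1 - z ^ 2) ^ 2 * (capDisc p q t z * √(capDisc p q t z))) *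
        polarInflection p q t z) s := by
  subst hsz
  have hz' : 0 < 1 - (1 - s ^ 2 / 3) ^ 2 := by linarith
  have hd : 0 < √(capDisc p q t (1 - s ^ 2 / 3)) := Real.sqrt_pos.2 hD
  have hdd : √(capDisc p q t (1 - s ^ 2 / 3)) ^ 2 = capDisc p q t (1 - s ^ 2 / 3) :=
    Real.sq_sqrt hD.le
  have h0 : HasDerivAt (fun s : ℝ => 1 - s ^ 2 / 3) (-(2 * s / 3)) s := by
    simpa using (((hasDerivAt_id s).pow 2).div_const 3).const_sub 1
  have h1 : HasDerivAt (fun s : ℝ => 2 * s ^ 2 / 3) (4 * s / 3) s := by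
    have := (((hasDerivAt_id s).pow 2).const_mul 2).div_const 3
    refine this.congr_deriv ?_
    simp; ring
  have h := ((hasDerivAt_azimuth hp hpq hz hD).comp s h0).sub
    (h1.mul ((hasDerivAt_azimuth_deriv hz hD).comp s h0))
  refine h.congr_deriv ?_
  rw [polarInflection]
  generalize equatorialInflection p q t (1 - s ^ 2 / 3) = E
  simp only [Function.comp]
  rw [← hdd]
  generalize √(capDisc p q t (1 - s ^ 2 / 3)) = d at hd
  simp only [Real.sqrt_sq hd.le]
  field_simp
  ring

/-! ### Continuity of the azimuth up to the poles. -/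

/-- The condition `q = t` says that the circle passes through the north pole. A factor `√(1 - z)`
then cancels in the argument of `arccos`, leaving `(q/p) √(1 - z)/√(1 + z)`, which tends to `0`. -/
theorem continuousWithinAt_azimuth_one {q t : ℝ} (p : ℝ) (hqt : q = t) :
    ContinuousWithinAt (azimuth p q t) (Set.Icc (-1) 1) 1 := by
  subst hqt
  have h : ContinuousWithinAt
      (fun z : ℝ => Real.arccos (q / p * (√(1 - z) / √(1 + z)))) (Set.Icc (-1) 1) 1 := by
    apply ContinuousAt.continuousWithinAt
    refine Real.continuous_arccos.continuousAt.comp ?_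
    refine continuousAt_const.mul (ContinuousAt.div ?_ ?_ ?_)
    · fun_prop
    · fun_prop
    · norm_num
  refine h.congr ?_ ?_
  · intro z hz
    rw [azimuth]
    congr 1
    have e : (1 - z ^ 2) = (1 - z) * (1 + z) := by ring
    rw [e, Real.sqrt_mul (by linarith [hz.2])]
    have e2 : q - q * z = q * (1 - z) := by ring
    have e3 : √(1 - z) = (1 - z) / √(1 - z) := (Real.div_sqrt).symm
    rw [e2]
    conv_rhs => rw [e3]
    rw [div_div, div_mul_div_comm]
  -- At `z = 1` the quotient is `0/0 = 0` by convention, which is also its limit.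
  · simp [azimuth]

theorem azimuth_neg (p q t z : ℝ) : azimuth p (-q) t (-z) = azimuth p q t z := by
  simp [azimuth]

theorem capDisc_neg (p q t z : ℝ) : capDisc p (-q) t (-z) = capDisc p q t z := by
  simp [capDisc]

theorem continuousWithinAt_azimuth {p q t z : ℝ} (hp : 0 < p) (hpq : p ^ 2 + q ^ 2 = 1)
    (hz : z ∈ Set.Icc (-1 : ℝ) 1) (hD : 0 ≤ capDisc p q t z) :
    ContinuousWithinAt (azimuth p q t) (Set.Icc (-1) 1) z := by
  rcases eq_or_lt_of_le hz.2 with h | h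
  · subst h
    refine continuousWithinAt_azimuth_one p ?_
    -- At `z = 1`, `capDisc` equals `-(q - t)²`; at `z = -1` below it equals `-(q + t)²`.
    have : (q - t) ^ 2 = 0 := by
      apply le_antisymm _ (sq_nonneg _)
      simp only [capDisc] at hD; linarith
    exact sub_eq_zero.1 (pow_eq_zero_iff two_ne_zero |>.1 this)
  rcases eq_or_lt_of_le hz.1 with h' | h'
  · subst h'
    have : (q + t) ^ 2 = 0 := by
      apply le_antisymm _ (sq_nonneg _)
      simp only [capDisc] at hD; linarith
    have hqt : -q = t := by
      linarith [(pow_eq_zero_iff two_ne_zero |>.1 this : q + t = 0)]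
    have h1 := continuousWithinAt_azimuth_one p hqt
    have h2 : ContinuousWithinAt (azimuth p (-q) t ∘ fun z => -z) (Set.Icc (-1) 1) (-1) := by
      refine ContinuousWithinAt.comp (t := Set.Icc (-1) 1) (by simpa using h1)
        continuous_neg.continuousWithinAt ?_
      intro x hx
      exact ⟨by linarith [hx.2], by linarith [hx.1]⟩
    refine h2.congr (fun x _ => ?_) ?_ <;> simp [Function.comp, ← azimuth_neg p q]
  · apply ContinuousAt.continuousWithinAt
    refine Real.continuous_arccos.continuousAt.comp ?_
    refine ContinuousAt.div (by fun_prop) (by fun_prop) ?_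
    have : 0 < 1 - z ^ 2 := by nlinarith
    positivity

/-! ### Trigonometric polynomials and their zeros. -/

open Polynomial in
/-- `f` is a real trigonometric polynomial of degree at most `n`. -/
def IsTrigPoly (n : ℕ) (f : ℝ → ℝ) : Prop :=
  ∃ P : ℂ[X], P.natDegree ≤ 2 * n ∧
    ∀ r : ℝ, P.eval (Complex.exp (r * Complex.I)) = Complex.exp (r * Complex.I) ^ n * (f r : ℂ)

namespace IsTrigPoly
open Polynomial

theorem const (a : ℝ) : IsTrigPoly 0 fun _ => a :=
  ⟨C (a : ℂ), by simp, by simp⟩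

theorem mul {n m : ℕ} {f g : ℝ → ℝ} (hf : IsTrigPoly n f) (hg : IsTrigPoly m g) :
    IsTrigPoly (n + m) fun r => f r * g r := by
  obtain ⟨P, hP, hP'⟩ := hf
  obtain ⟨Q, hQ, hQ'⟩ := hg
  refine ⟨P * Q, natDegree_mul_le.trans (by omega), fun r => ?_⟩
  rw [eval_mul, hP', hQ']
  push_cast
  ring

theorem mono {n m : ℕ} {f : ℝ → ℝ} (hf : IsTrigPoly n f) (h : n ≤ m) : IsTrigPoly m f := by
  obtain ⟨P, hP, hP'⟩ := hf
  refine ⟨P * X ^ (m - n), natDegree_mul_le.trans (by rw [natDegree_X_pow]; omega), fun r => ?_⟩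
  rw [eval_mul, hP', eval_pow, eval_X]
  obtain ⟨k, rfl⟩ := Nat.exists_eq_add_of_le h
  rw [Nat.add_sub_cancel_left]
  ring

theorem add {n : ℕ} {f g : ℝ → ℝ} (hf : IsTrigPoly n f) (hg : IsTrigPoly n g) :
    IsTrigPoly n fun r => f r + g r := by
  obtain ⟨P, hP, hP'⟩ := hf
  obtain ⟨Q, hQ, hQ'⟩ := hg
  refine ⟨P + Q, (natDegree_add_le _ _).trans (max_le hP hQ), fun r => ?_⟩
  rw [eval_add, hP', hQ']
  push_cast
  ring

theorem const_mul {n : ℕ} {f : ℝ → ℝ} (a : ℝ) (hf : IsTrigPoly n f) :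
    IsTrigPoly n fun r => a * f r := by
  simpa using (const a).mul hf

theorem sub {n : ℕ} {f g : ℝ → ℝ} (hf : IsTrigPoly n f) (hg : IsTrigPoly n g) :
    IsTrigPoly n fun r => f r - g r := by
  simpa [sub_eq_add_neg] using hf.add (hg.const_mul (-1))

theorem cos : IsTrigPoly 1 Real.cos := by
  refine ⟨C (1 / 2) * X ^ 2 + C (1 / 2), by compute_degree, fun r => ?_⟩
  have h : Complex.exp (r * Complex.I) * Complex.exp (-(r * Complex.I)) = 1 := by
    rw [← Complex.exp_add]; simp
  simp only [eval_add, eval_mul, eval_C, eval_pow, eval_X, Complex.ofReal_cos, Complex.cos, neg_mul]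
  linear_combination (-1 / 2) * h

theorem sin : IsTrigPoly 1 Real.sin := by
  refine ⟨C (-Complex.I / 2) * X ^ 2 + C (Complex.I / 2), by compute_degree, fun r => ?_⟩
  have h : Complex.exp (r * Complex.I) * Complex.exp (-(r * Complex.I)) = 1 := by
    rw [← Complex.exp_add]; simp
  simp only [eval_add, eval_mul, eval_C, eval_pow, eval_X, Complex.ofReal_sin, Complex.sin, neg_mul]
  linear_combination (-Complex.I / 2) * h

theorem affine (a b d : ℝ) : IsTrigPoly 1 fun r => a + b * Real.cos r + d * Real.sin r :=
  (((const a).mono zero_le_one).add (cos.const_mul b)).add (sin.const_mul d)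

theorem periodic {n : ℕ} {f : ℝ → ℝ} (hf : IsTrigPoly n f) :
    Function.Periodic f (2 * Real.pi) := by
  obtain ⟨P, -, hP⟩ := hf
  intro r
  have h := hP (r + 2 * Real.pi)
  have e : Complex.exp (((r + 2 * Real.pi : ℝ) : ℂ) * Complex.I) = Complex.exp (r * Complex.I) := by
    push_cast
    rw [add_mul, Complex.exp_add, Complex.exp_two_pi_mul_I, mul_one]
  rw [e, hP r] at h
  exact_mod_cast (mul_left_cancel₀ (pow_ne_zero _ (Complex.exp_ne_zero _)) h).symm

/-- The map `r ↦ exp (i r)` is injective on a half-open period and sends zeros of `f` to roots of a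
nonzero polynomial of degree at most `2n`. -/
theorem encard_roots_le {n : ℕ} {f : ℝ → ℝ} (hf : IsTrigPoly n f) (hne : ∃ r, f r ≠ 0) (x : ℝ) :
    ({r | f r = 0} ∩ Set.Ico x (x + 2 * Real.pi)).encard ≤ (2 * n : ℕ) := by
  obtain ⟨P, hd, hP⟩ := hf
  have hP0 : P ≠ 0 := by
    rintro rfl
    obtain ⟨r, hr⟩ := hne
    have := hP r
    simp [hr] at this
  have hinj : Set.InjOn (fun r : ℝ => Complex.exp (r * Complex.I))
      ({r | f r = 0} ∩ Set.Ico x (x + 2 * Real.pi)) := by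
    intro a ha b hb hab
    obtain ⟨k, hk⟩ := Complex.exp_eq_exp_iff_exists_int.1 hab
    have h1 : a = b + k * (2 * Real.pi) := by
      have : ((a : ℂ) - (b + k * (2 * Real.pi))) * Complex.I = 0 := by linear_combination hk
      have h2 := (mul_eq_zero.1 this).resolve_right Complex.I_ne_zero
      have h3 : ((a - (b + k * (2 * Real.pi)) : ℝ) : ℂ) = 0 := by push_cast; exact h2
      have := Complex.ofReal_eq_zero.1 h3
      linarith
    have hpi := Real.pi_pos
    obtain ⟨-, ha1, ha2⟩ := ha
    obtain ⟨-, hb1, hb2⟩ := hb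
    have hk1 : (k : ℝ) < 1 := by
      by_contra hcon
      nlinarith [not_lt.1 hcon]
    have hk2 : (-1 : ℝ) < k := by
      by_contra hcon
      nlinarith [not_lt.1 hcon]
    have : k = 0 := by
      have a1 : k < 1 := by exact_mod_cast hk1
      have a2 : -1 < k := by exact_mod_cast hk2
      omega
    simpa [this] using h1
  have hmaps : (fun r : ℝ => Complex.exp (r * Complex.I)) ''
      ({r | f r = 0} ∩ Set.Ico x (x + 2 * Real.pi)) ⊆ (P.roots.toFinset : Set ℂ) := by
    rintro _ ⟨r, hr, rfl⟩
    have h0 : f r = 0 := hr.1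
    simp [hP0, hP, h0]
  rw [← hinj.encard_image]
  refine (Set.encard_le_encard hmaps).trans ?_
  rw [Set.encard_coe_eq_coe_finsetCard]
  exact_mod_cast (Multiset.toFinset_card_le _).trans ((card_roots' P).trans hd)

end IsTrigPoly

/-! ### From convex gaps to pieces of the curve. -/

open Set Filter Topology in
/-- On the open interval `(a,b)`, `Γ ∘ c` is defined and agrees with a curve which is continuous
on `[a,b]` and runs in the boundary of a convex set. -/
def IsConvexGap (c : ℝ → S2) (a b : ℝ) : Prop :=
  ∃ β : ℝ → ℝ × ℝ, ContinuousOn β (Icc a b) ∧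
    (∃ A : Set (ℝ × ℝ), Convex ℝ A ∧ β '' Icc a b ⊆ frontier A) ∧
    ∀ r ∈ Ioo a b, c r ∉ poles ∧ healpixProj (c r) = β r

theorem exists_sorted_partition (G : Finset ℝ) {a b : ℝ} (hab : a < b) (ha : a ∈ G) (hb : b ∈ G)
    (hG : ∀ x ∈ G, x ∈ Set.Icc a b) :
    ∃ (n : ℕ) (τ : Fin (n + 1) → ℝ), 1 ≤ n ∧ n + 1 = G.card ∧ StrictMono τ ∧ τ 0 = a ∧
      τ (Fin.last n) = b ∧ (∀ j, τ j ∈ G) ∧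
      ∀ j : Fin n, ∀ x ∈ G, x ∉ Set.Ioo (τ j.castSucc) (τ j.succ) := by
  have h2 : 2 ≤ G.card := by
    have : ({a, b} : Finset ℝ) ⊆ G := by
      intro x hx
      rcases Finset.mem_insert.1 hx with rfl | hx
      · exact ha
      · rw [Finset.mem_singleton.1 hx]; exact hb
    have h := Finset.card_le_card this
    rwa [Finset.card_pair hab.ne] at h
  obtain ⟨n, hn⟩ : ∃ n, G.card = n + 1 := ⟨G.card - 1, by omega⟩
  have hsurj : ∀ x ∈ G, ∃ j, G.orderEmbOfFin hn j = x := by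
    intro x hx
    have := Finset.range_orderEmbOfFin G hn
    have hx' : x ∈ Set.range (G.orderEmbOfFin hn) := by rw [this]; exact hx
    exact hx'
  have hmem : ∀ j, G.orderEmbOfFin hn j ∈ G := fun j => Finset.orderEmbOfFin_mem G hn j
  refine ⟨n, G.orderEmbOfFin hn, by omega, hn.symm, (G.orderEmbOfFin hn).strictMono, ?_, ?_, hmem,
    ?_⟩
  · obtain ⟨j, hj⟩ := hsurj a ha
    apply le_antisymm
    · rw [← hj]; exact (G.orderEmbOfFin hn).monotone (Fin.zero_le j)
    · exact (hG _ (hmem 0)).1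
  · obtain ⟨j, hj⟩ := hsurj b hb
    apply le_antisymm
    · exact (hG _ (hmem _)).2
    · rw [← hj]; exact (G.orderEmbOfFin hn).monotone (Fin.le_last j)
  · rintro j x hx ⟨h1, h3⟩
    obtain ⟨i, rfl⟩ := hsurj x hx
    have h1' := (G.orderEmbOfFin hn).lt_iff_lt.1 h1
    have h3' := (G.orderEmbOfFin hn).lt_iff_lt.1 h3
    rw [Fin.lt_def] at h1' h3'
    simp only [Fin.val_castSucc, Fin.val_succ] at h1' h3'
    omega

theorem isClosed_poles : IsClosed poles := by
  have h (i : Fin 3) : Continuous fun x : S2 => (x : E3) i := by fun_prop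
  exact (isClosed_eq (h 0) continuous_const).inter (isClosed_eq (h 1) continuous_const)

theorem continuousAt_healpixProj_comp {w : S2} {t : ℝ} {c : ℝ → S2} (hc : Continuous c)
    (hmem : ∀ r, c r ∈ capBoundary w t) {r : ℝ} (hr : c r ∉ breakPoints w t) :
    c r ∉ poles ∧ ContinuousAt (healpixProj ∘ c) r := by
  have h : ¬(c r ∈ poles ∨ ¬ ContinuousWithinAt healpixProj (capBoundary w t \ poles) (c r)) :=
    fun h => hr ⟨hmem r, h⟩
  push Not at h
  refine ⟨h.1, h.2.tendsto.comp ?_⟩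
  refine tendsto_nhdsWithin_iff.2 ⟨hc.continuousAt, ?_⟩
  filter_upwards [hc.continuousAt.eventually (isClosed_poles.isOpen_compl.mem_nhds h.1)] with x hx
  exact ⟨hmem x, hx⟩

set_option maxHeartbeats 800000 in
/-- An arc without breaks between two special points is `n`-convex, where `n` counts its gaps. -/
theorem exists_isNConvex_arc {c : ℝ → S2} {T : Set ℝ} {N : ℕ} {a b : ℝ} (hab : a < b)
    (ha : a ∈ T) (hb : b ∈ T) (hcard : (T ∩ Set.Ico a b).encard ≤ N)
    (hgap : ∀ a' b', a' < b' → (∀ x ∈ T, x ∉ Set.Ioo a' b') → IsConvexGap c a' b')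
    (hcont : ∀ r ∈ T, r ∈ Set.Ioo a b → c r ∉ poles ∧ ContinuousAt (healpixProj ∘ c) r) :
    ∃ (n : ℕ) (β : ℝ → ℝ × ℝ), n ≤ N ∧ IsNConvex n a b β ∧
      ∀ r ∈ Set.Ioo a b, c r ∉ poles ∧ healpixProj (c r) = β r := by
  have hfin0 : (T ∩ Set.Ico a b).Finite :=
    Set.finite_of_encard_le_coe hcard
  have hfin : (T ∩ Set.Icc a b).Finite := by
    refine (hfin0.insert b).subset ?_
    rintro x ⟨hx, hx1, hx2⟩
    rcases eq_or_lt_of_le hx2 with h | h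
    · exact Or.inl h
    · exact Or.inr ⟨hx, hx1, h⟩
  obtain ⟨n, τ, hn1, hn, hτ, hτ0, hτl, hτT, hτgap⟩ := exists_sorted_partition hfin.toFinset hab
    (by simp [ha, hab.le]) (by simp [hb, hab.le]) (by simp)
  have hnN : n ≤ N := by
    have h1 : hfin.toFinset ⊆ insert b hfin0.toFinset := by
      intro x hx
      have hx' : x ∈ T ∩ Set.Icc a b := by simpa using hx
      rcases eq_or_lt_of_le hx'.2.2 with h | h
      · simp [h]
      · simp [hx'.1, hx'.2.1, h]
    have h2 := (Finset.card_le_card h1).trans (Finset.card_insert_le _ _)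
    rw [hfin0.encard_eq_coe_toFinset_card] at hcard
    have h3 : hfin0.toFinset.card ≤ N := by exact_mod_cast hcard
    omega
  have hτmem (j) : τ j ∈ Set.Icc a b := by
    have := hτT j
    simp only [Set.Finite.mem_toFinset] at this
    exact this.2
  have hlt (j : Fin n) : τ j.castSucc < τ j.succ := hτ (Fin.castSucc_lt_succ)
  have hg (j : Fin n) : IsConvexGap c (τ j.castSucc) (τ j.succ) := by
    refine hgap _ _ (hlt j) fun x hx hx' => hτgap j x ?_ hx'
    simp only [Set.Finite.mem_toFinset]
    exact ⟨hx, (hτmem _).1.trans hx'.1.le, hx'.2.le.trans (hτmem _).2⟩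
  have hsub (j : Fin n) : Set.Ioo (τ j.castSucc) (τ j.succ) ⊆ Set.Ioo a b := fun x hx =>
    ⟨(hτmem _).1.trans_lt hx.1, hx.2.trans_le (hτmem _).2⟩
  choose β hβc hβA hβe using hg
  have hall : ∀ r ∈ Set.Ioo a b, c r ∉ poles ∧ ContinuousAt (healpixProj ∘ c) r := by
    intro r hr
    by_cases hrT : r ∈ T
    · exact hcont r hrT hr
    -- Away from the finitely many special parameters, a small interval around `r` is itself a gap,
    -- so continuity comes from its local curve.
    have ho : (T ∩ Set.Icc a b)ᶜ ∩ Set.Ioo a b ∈ nhds r :=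
      Filter.inter_mem (hfin.isClosed.isOpen_compl.mem_nhds fun h => hrT h.1)
        (isOpen_Ioo.mem_nhds hr)
    obtain ⟨l, u, hlu, hsubset⟩ := mem_nhds_iff_exists_Ioo_subset.1 ho
    obtain ⟨γ, hγc, -, hγe⟩ := hgap l u (hlu.1.trans hlu.2) fun x hx hx' =>
      (hsubset hx').1 ⟨hx, (hsubset hx').2.1.le, (hsubset hx').2.2.le⟩
    refine ⟨(hγe r hlu).1, ?_⟩
    refine (hγc.continuousAt (Icc_mem_nhds hlu.1 hlu.2)).congr ?_
    filter_upwards [isOpen_Ioo.mem_nhds hlu] with x hx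
    exact (hγe x hx).2.symm
  set f : ℝ → ℝ × ℝ := healpixProj ∘ c with hf
  have hfc : ContinuousOn f (Set.Ioo a b) := fun r hr => (hall r hr).2.continuousWithinAt
  -- The one-sided limits at the ends are supplied by the curves of the first and the last gap; they
  -- allow extension to the closed arc.
  have hla : ∃ l, Filter.Tendsto f (nhdsWithin a (Set.Ioi a)) (nhds l) := by
    have e1 : τ (Fin.castSucc ⟨0, hn1⟩) = a := hτ0
    refine ⟨β ⟨0, hn1⟩ a, ?_⟩
    have h0 := hlt ⟨0, hn1⟩
    have h1 := hβc ⟨0, hn1⟩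
    have h2 := hβe ⟨0, hn1⟩
    rw [e1] at h0 h1 h2
    have h3 := (h1 a ⟨le_rfl, h0.le⟩).mono Set.Ioo_subset_Icc_self
    rw [← nhdsWithin_Ioo_eq_nhdsGT h0]
    refine h3.tendsto.congr' ?_
    filter_upwards [self_mem_nhdsWithin] with x hx
    exact (h2 x hx).2.symm
  have hlb : ∃ l, Filter.Tendsto f (nhdsWithin b (Set.Iio b)) (nhds l) := by
    have hlast : n - 1 < n := by omega
    have e1 : τ (Fin.succ ⟨n - 1, hlast⟩) = b := by
      rw [← hτl]; congr 1; ext; simp; omega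
    refine ⟨β ⟨n - 1, hlast⟩ b, ?_⟩
    have h0 := hlt ⟨n - 1, hlast⟩
    have h1 := hβc ⟨n - 1, hlast⟩
    have h2 := hβe ⟨n - 1, hlast⟩
    rw [e1] at h0 h1 h2
    have h3 := (h1 b ⟨h0.le, le_rfl⟩).mono Set.Ioo_subset_Icc_self
    rw [← nhdsWithin_Ioo_eq_nhdsLT h0]
    refine h3.tendsto.congr' ?_
    filter_upwards [self_mem_nhdsWithin] with x hx
    exact (h2 x hx).2.symm
  obtain ⟨la, hla⟩ := hla
  obtain ⟨lb, hlb⟩ := hlb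
  have hext := continuousOn_Icc_extendFrom_Ioo hfc hla hlb
  have heq : ∀ r ∈ Set.Ioo a b, extendFrom (Set.Ioo a b) f r = f r := fun r hr =>
    extendFrom_eq (subset_closure hr) (hfc r hr)
  refine ⟨n, extendFrom (Set.Ioo a b) f, hnN, ⟨hab, hext, τ, hτ, hτ0, hτl, fun j => ?_⟩,
    fun r hr => ⟨(hall r hr).1, (heq r hr).symm⟩⟩
  obtain ⟨A, hA, hAf⟩ := hβA j
  refine ⟨A, hA, ?_⟩
  -- Two continuous functions that agree on the open gap agree on its closure.
  have hE : Set.EqOn (extendFrom (Set.Ioo a b) f) (β j)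
      (Set.Icc (τ j.castSucc) (τ j.succ)) := by
    refine Set.EqOn.of_subset_closure (s := Set.Ioo (τ j.castSucc) (τ j.succ)) ?_
      (hext.mono (Set.Icc_subset_Icc (hτmem _).1 (hτmem _).2)) (hβc j) Set.Ioo_subset_Icc_self
      (closure_Ioo (hlt j).ne).ge
    intro x hx
    rw [heq x (hsub j hx)]
    exact (hβe j x hx).2
  rwa [hE.image_eq]

/-- Cutting a closed curve into arcs, given a periodic set of special parameters
whose gaps have convex images. -/
theorem exists_nConvex_pieces {w : S2} {t : ℝ} {c : ℝ → S2} (hc : Continuous c)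
    (hper : Function.Periodic c (2 * Real.pi))
    (hbij : ∀ x, Set.BijOn c (Set.Ico x (x + 2 * Real.pi)) (capBoundary w t))
    {T : Set ℝ} {N : ℕ} (hT0 : (0 : ℝ) ∈ T) (hTper : ∀ r ∈ T, r + 2 * Real.pi ∈ T)
    (hcard : ∀ x, (T ∩ Set.Ico x (x + 2 * Real.pi)).encard ≤ N)
    (hgap : ∀ a' b', a' < b' → (∀ x ∈ T, x ∉ Set.Ioo a' b') → IsConvexGap c a' b') :
    ∃ (m : ℕ) (s : Fin (m + 1) → ℝ) (c : ℝ → S2),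
      1 ≤ m ∧ m ≤ N ∧ StrictMono s ∧
      ContinuousOn c (Set.Icc (s 0) (s (Fin.last m))) ∧
      c (s 0) = c (s (Fin.last m)) ∧
      Set.BijOn c (Set.Ico (s 0) (s (Fin.last m))) (capBoundary w t) ∧
      (m = 1 ∨ ∀ i, c (s i) ∈ breakPoints w t) ∧
      ∀ i : Fin m, ∃ (n : ℕ) (β : ℝ → ℝ × ℝ), n ≤ N ∧
        IsNConvex n (s i.castSucc) (s i.succ) β ∧
        ∀ r ∈ Set.Ioo (s i.castSucc) (s i.succ),
          c r ∉ poles ∧ healpixProj (c r) = β r := by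
  have hpi : 0 < 2 * Real.pi := by positivity
  have hmem : ∀ r, c r ∈ capBoundary w t := fun r =>
    (hbij r).mapsTo ⟨le_rfl, by linarith⟩
  have hNpos : 1 ≤ N := by
    have h1 : ({0} : Set ℝ).encard ≤ N :=
      (Set.encard_le_encard (Set.singleton_subset_iff.2
        (show (0 : ℝ) ∈ T ∩ Set.Ico 0 (0 + 2 * Real.pi) from ⟨hT0, le_rfl, by linarith⟩))).trans (hcard 0)
    rw [Set.encard_singleton] at h1
    exact_mod_cast h1
  by_cases hB : ∃ s0 ∈ T, c s0 ∈ breakPoints w t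
  -- Starting the period at a break makes both of its ends, which are the same point of the circle,
  -- legitimate cuts.
  · obtain ⟨s0, hs0, hs0B⟩ := hB
    have hfin0 : (T ∩ Set.Ico s0 (s0 + 2 * Real.pi)).Finite :=
      Set.finite_of_encard_le_coe (hcard s0)
    let B : Set ℝ := {r | r ∈ T ∧ c r ∈ breakPoints w t} ∩ Set.Icc s0 (s0 + 2 * Real.pi)
    have hBsub : B ⊆ insert (s0 + 2 * Real.pi) (T ∩ Set.Ico s0 (s0 + 2 * Real.pi)) := by
      rintro x ⟨⟨hx, -⟩, hx1, hx2⟩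
      rcases eq_or_lt_of_le hx2 with h | h
      · exact Or.inl h
      · exact Or.inr ⟨hx, hx1, h⟩
    have hBfin : B.Finite := (hfin0.insert _).subset hBsub
    obtain ⟨m, s, hm1, hm, hs, hs_zero, hs_last, hsB, hsgap⟩ :=
      exists_sorted_partition hBfin.toFinset (a := s0) (b := s0 + 2 * Real.pi) (by linarith)
        (by rw [Set.Finite.mem_toFinset]; exact ⟨⟨hs0, hs0B⟩, le_rfl, by linarith⟩)
        (by
          rw [Set.Finite.mem_toFinset]
          exact ⟨⟨hTper _ hs0, by rw [hper]; exact hs0B⟩, by linarith, le_rfl⟩)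
        (fun x hx => by rw [Set.Finite.mem_toFinset] at hx; exact hx.2)
    have hsB' (j) : s j ∈ B := by simpa using hsB j
    have hmN : m ≤ N := by
      have h1 : hBfin.toFinset ⊆ insert (s0 + 2 * Real.pi) hfin0.toFinset := by
        intro x hx
        have := hBsub (by simpa using hx)
        simpa using this
      have h2 := (Finset.card_le_card h1).trans (Finset.card_insert_le _ _)
      have h3 := hcard s0
      rw [hfin0.encard_eq_coe_toFinset_card] at h3
      have h4 : hfin0.toFinset.card ≤ N := by exact_mod_cast h3
      omega
    refine ⟨m, s, c, hm1, hmN, hs, hc.continuousOn, ?_, ?_, Or.inr fun i => (hsB' i).1.2, ?_⟩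
    · rw [hs_zero, hs_last, hper]
    · rw [hs_zero, hs_last]; exact hbij s0
    · intro i
      refine exists_isNConvex_arc (hs Fin.castSucc_lt_succ) (hsB' _).1.1 (hsB' _).1.1 ?_ hgap ?_
      · refine (Set.encard_le_encard ?_).trans (hcard (s i.castSucc))
        refine Set.inter_subset_inter_right _ (Set.Ico_subset_Ico_right ?_)
        linarith [(hsB' i.castSucc).2.1, (hsB' i.succ).2.2]
      · intro r hrT hr
        refine continuousAt_healpixProj_comp hc hmem fun hbr => ?_
        refine hsgap i r ?_ hr
        rw [Set.Finite.mem_toFinset]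
        exact ⟨⟨hrT, hbr⟩, (hsB' _).2.1.trans hr.1.le, hr.2.le.trans (hsB' _).2.2⟩
  · push Not at hB
    -- No special parameter is a break: one cut, at the special parameter `0`, leaves a single
    -- piece.
    refine ⟨1, ![0, 0 + 2 * Real.pi], c, le_rfl, hNpos, ?_, hc.continuousOn, ?_, ?_, Or.inl rfl, ?_⟩
    · intro i j hij
      fin_cases i <;> fin_cases j <;> simp at hij ⊢
      exact Real.pi_pos
    · exact (hper 0).symm
    · exact hbij 0
    · intro i
      fin_cases i
      exact exists_isNConvex_arc (a := 0) (b := 0 + 2 * Real.pi) (by linarith) hT0 (hTper _ hT0)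
        (hcard 0) hgap fun r hrT _ => continuousAt_healpixProj_comp hc hmem (hB r hrT)

/-! ### Constant signs and the longitude. -/

/-- The function `f` has constant sign (possibly zero) on the interval `(a,b)`. -/
def HasConstSign (f : ℝ → ℝ) (a b : ℝ) : Prop :=
  (∀ r ∈ Set.Ioo a b, 0 < f r) ∨ (∀ r ∈ Set.Ioo a b, f r < 0) ∨ ∀ r ∈ Set.Ioo a b, f r = 0

theorem hasConstSign_of_ne_zero {f : ℝ → ℝ} (hf : Continuous f) {a b : ℝ}
    (h : (∀ r, f r = 0) ∨ ∀ r ∈ Set.Ioo a b, f r ≠ 0) : HasConstSign f a b := by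
  rcases h with h | h
  · exact Or.inr (Or.inr fun r _ => h r)
  by_cases hpos : ∃ r ∈ Set.Ioo a b, 0 < f r
  · obtain ⟨x, hx, hfx⟩ := hpos
    refine Or.inl fun y hy => ?_
    by_contra hcon
    obtain ⟨z, hz, hz0⟩ := isPreconnected_Ioo.intermediate_value hy hx hf.continuousOn
      (show (0 : ℝ) ∈ Set.Icc (f y) (f x) from ⟨not_lt.1 hcon, hfx.le⟩)
    exact h z hz hz0
  · push Not at hpos
    exact Or.inr (Or.inl fun r hr => lt_of_le_of_ne (hpos r hr) (h r hr))

theorem longitude_cos_sin (x : S2) {R θ : ℝ} (hR : 0 < R) (h0 : (x : E3) 0 = R * Real.cos θ)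
    (h1 : (x : E3) 1 = R * Real.sin θ) :
    Real.cos (longitude x) = Real.cos θ ∧ Real.sin (longitude x) = Real.sin θ := by
  set v : ℂ := ⟨(x : E3) 0, (x : E3) 1⟩ with hv
  have hn : ‖v‖ = R := by
    rw [Complex.norm_def, Complex.normSq_mk, h0, h1]
    rw [show R * Real.cos θ * (R * Real.cos θ) + R * Real.sin θ * (R * Real.sin θ) = R ^ 2 by
      linear_combination R ^ 2 * Real.sin_sq_add_cos_sq θ]
    exact Real.sqrt_sq hR.le
  have hv0 : v ≠ 0 := by rw [← norm_pos_iff, hn]; exact hR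
  have hc : Real.cos v.arg = Real.cos θ := by
    rw [Complex.cos_arg hv0, hn]; simp only [hv, h0]; field_simp
  have hs : Real.sin v.arg = Real.sin θ := by
    rw [Complex.sin_arg, hn]; simp only [hv, h1]; field_simp
  rw [longitude, ← hv]
  split_ifs
  · exact ⟨hc, hs⟩
  · rw [Real.cos_add_two_pi, Real.sin_add_two_pi]; exact ⟨hc, hs⟩

theorem longitude_of_nonneg {x : S2} (h : 0 ≤ (x : E3) 1) :
    longitude x = Complex.arg ⟨(x : E3) 0, (x : E3) 1⟩ :=
  if_pos (Complex.arg_nonneg_iff.2 h)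

theorem longitude_of_neg {x : S2} (h : (x : E3) 1 < 0) :
    longitude x = Complex.arg ⟨(x : E3) 0, (x : E3) 1⟩ + 2 * Real.pi :=
  if_neg (not_le.2 (Complex.arg_neg_iff.2 h))

theorem floor_longitude {x : S2} {j : ℤ} (h1 : j * (Real.pi / 2) ≤ longitude x)
    (h2 : longitude x < (j + 1) * (Real.pi / 2)) : ⌊longitude x / (Real.pi / 2)⌋ = j := by
  rw [Int.floor_eq_iff]
  have : 0 < Real.pi / 2 := by positivity
  exact ⟨(le_div_iff₀ this).2 h1, (div_lt_iff₀ this).2 h2⟩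

/-- The signs of `x` and `y` determine the quadrant. Quadrants are half-open, so each half-axis
belongs to the quadrant that it begins; this settles the cases where one coordinate vanishes
identically. -/
theorem exists_floor_longitude {c : ℝ → S2} {a b : ℝ}
    (hs0 : HasConstSign (fun r => (c r : E3) 0) a b)
    (hs1 : HasConstSign (fun r => (c r : E3) 1) a b)
    (hp : ∀ r ∈ Set.Ioo a b, c r ∉ poles) :
    ∃ j : ℤ, ∀ r ∈ Set.Ioo a b, ⌊longitude (c r) / (Real.pi / 2)⌋ = j := by
  have hpi := Real.pi_pos
  have q0 : ∀ x : S2, 0 < (x : E3) 0 → 0 ≤ (x : E3) 1 →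
      ⌊longitude x / (Real.pi / 2)⌋ = 0 := by
    intro x h0 h1
    have e := longitude_of_nonneg h1
    have b1 := Complex.arg_nonneg_iff.2 (show 0 ≤ (⟨(x : E3) 0, (x : E3) 1⟩ : ℂ).im from h1)
    have b2 := Complex.abs_arg_lt_pi_div_two_iff.2
      (Or.inl (show 0 < (⟨(x : E3) 0, (x : E3) 1⟩ : ℂ).re from h0))
    have b3 := (abs_lt.1 b2).2
    apply floor_longitude <;> push_cast <;> linarith
  have q1 : ∀ x : S2, (x : E3) 0 ≤ 0 → 0 < (x : E3) 1 →
      ⌊longitude x / (Real.pi / 2)⌋ = 1 := by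
    intro x h0 h1
    have e := longitude_of_nonneg h1.le
    have b1 := Complex.arg_nonneg_iff.2 (show 0 ≤ (⟨(x : E3) 0, (x : E3) 1⟩ : ℂ).im from h1.le)
    have b2 : Real.pi / 2 ≤ |Complex.arg ⟨(x : E3) 0, (x : E3) 1⟩| := by
      by_contra hcon
      rcases Complex.abs_arg_lt_pi_div_two_iff.1 (not_le.1 hcon) with h | h
      · exact absurd h (not_lt.2 h0)
      · exact h1.ne' (congrArg Complex.im h)
    rw [abs_of_nonneg b1] at b2
    have b3 : Complex.arg ⟨(x : E3) 0, (x : E3) 1⟩ < Real.pi :=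
      lt_of_le_of_ne (Complex.arg_le_pi _) fun h => h1.ne' (Complex.arg_eq_pi_iff.1 h).2
    apply floor_longitude <;> push_cast <;> linarith
  have q2 : ∀ x : S2, (x : E3) 0 < 0 → (x : E3) 1 ≤ 0 →
      ⌊longitude x / (Real.pi / 2)⌋ = 2 := by
    intro x h0 h1
    rcases eq_or_lt_of_le h1 with h1 | h1
    · have e := longitude_of_nonneg h1.ge
      have b3 : Complex.arg ⟨(x : E3) 0, (x : E3) 1⟩ = Real.pi :=
        Complex.arg_eq_pi_iff.2 ⟨h0, h1⟩
      apply floor_longitude <;> push_cast <;> linarith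
    · have e := longitude_of_neg h1
      have b1 := Complex.arg_neg_iff.2 (show (⟨(x : E3) 0, (x : E3) 1⟩ : ℂ).im < 0 from h1)
      have b2 : Real.pi / 2 < |Complex.arg ⟨(x : E3) 0, (x : E3) 1⟩| := by
        by_contra hcon
        exact absurd (Complex.abs_arg_le_pi_div_two_iff.1 (not_lt.1 hcon)) (not_le.2 h0)
      rw [abs_of_neg b1] at b2
      have b3 := Complex.neg_pi_lt_arg ⟨(x : E3) 0, (x : E3) 1⟩
      apply floor_longitude <;> push_cast <;> linarith
  have q3 : ∀ x : S2, 0 ≤ (x : E3) 0 → (x : E3) 1 < 0 →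
      ⌊longitude x / (Real.pi / 2)⌋ = 3 := by
    intro x h0 h1
    have e := longitude_of_neg h1
    have b1 := Complex.arg_neg_iff.2 (show (⟨(x : E3) 0, (x : E3) 1⟩ : ℂ).im < 0 from h1)
    have b2 := Complex.abs_arg_le_pi_div_two_iff.2
      (show 0 ≤ (⟨(x : E3) 0, (x : E3) 1⟩ : ℂ).re from h0)
    have b3 := (abs_le.1 b2).1
    apply floor_longitude <;> push_cast <;> linarith
  rcases hs0 with h0 | h0 | h0 <;> rcases hs1 with h1 | h1 | h1
  · exact ⟨0, fun r hr => q0 _ (h0 r hr) (h1 r hr).le⟩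
  · exact ⟨3, fun r hr => q3 _ (h0 r hr).le (h1 r hr)⟩
  · exact ⟨0, fun r hr => q0 _ (h0 r hr) (h1 r hr).ge⟩
  · exact ⟨1, fun r hr => q1 _ (h0 r hr).le (h1 r hr)⟩
  · exact ⟨2, fun r hr => q2 _ (h0 r hr) (h1 r hr).le⟩
  · exact ⟨2, fun r hr => q2 _ (h0 r hr) (h1 r hr).le⟩
  · exact ⟨1, fun r hr => q1 _ (h0 r hr).le (h1 r hr)⟩
  · exact ⟨3, fun r hr => q3 _ (h0 r hr).ge (h1 r hr)⟩
  · exact ⟨0, fun r hr => absurd ⟨h0 r hr, h1 r hr⟩ (hp r hr)⟩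

/-- The only jump is across the half-plane `y = 0`, `x > 0`. An arc either avoids `y = 0`, or lies
in it with `x` of one sign and has constant longitude `0` or `π`. -/
theorem continuousOn_longitude {c : ℝ → S2} (hc : Continuous c) {a b : ℝ}
    (hs0 : HasConstSign (fun r => (c r : E3) 0) a b)
    (hs1 : HasConstSign (fun r => (c r : E3) 1) a b)
    (hp : ∀ r ∈ Set.Ioo a b, c r ∉ poles) :
    ContinuousOn (fun r => longitude (c r)) (Set.Ioo a b) := by
  have hv : Continuous fun r => (⟨(c r : E3) 0, (c r : E3) 1⟩ : ℂ) := by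
    have h0 : Continuous fun r => (c r : E3) 0 := by fun_prop
    have h1 : Continuous fun r => (c r : E3) 1 := by fun_prop
    have := (Complex.continuous_ofReal.comp h0).add
      ((Complex.continuous_ofReal.comp h1).mul (continuous_const (y := Complex.I)))
    refine this.congr fun r => ?_
    apply Complex.ext <;> simp
  have harg : (∀ r ∈ Set.Ioo a b, (c r : E3) 1 ≠ 0) →
      ContinuousOn (fun r => Complex.arg ⟨(c r : E3) 0, (c r : E3) 1⟩) (Set.Ioo a b) := by
    intro h r hr
    refine ContinuousAt.continuousWithinAt ?_
    exact (Complex.continuousAt_arg (Complex.mem_slitPlane_iff.2 (Or.inr (h r hr)))).comp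
      hv.continuousAt
  rcases hs1 with h1 | h1 | h1
  · exact (harg fun r hr => (h1 r hr).ne').congr fun r hr => longitude_of_nonneg (h1 r hr).le
  · exact ((harg fun r hr => (h1 r hr).ne).add continuousOn_const).congr
      fun r hr => longitude_of_neg (h1 r hr)
  · rcases hs0 with h0 | h0 | h0
    · refine (continuousOn_const (c := (0 : ℝ))).congr fun r hr => ?_
      rw [longitude_of_nonneg (h1 r hr).ge]
      exact Complex.arg_eq_zero_iff.2 ⟨(h0 r hr).le, h1 r hr⟩
    · refine (continuousOn_const (c := Real.pi)).congr fun r hr => ?_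
      rw [longitude_of_nonneg (h1 r hr).ge]
      exact Complex.arg_eq_pi_iff.2 ⟨h0 r hr, h1 r hr⟩
    · exact fun r hr => absurd ⟨h0 r hr, h1 r hr⟩ (hp r hr)

/-- Where the coordinates `x`, `y` keep their signs, the longitude is any continuous choice
of the polar angle, up to a constant, and `φ mod π/2` differs from it by a constant. -/
theorem exists_longitude_eq {c : ℝ → S2} (hc : Continuous c) {a b : ℝ} {R θ : ℝ → ℝ}
    (hθ : ContinuousOn θ (Set.Ioo a b)) (hR : ∀ r ∈ Set.Ioo a b, 0 < R r)
    (h0 : ∀ r ∈ Set.Ioo a b, (c r : E3) 0 = R r * Real.cos (θ r))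
    (h1 : ∀ r ∈ Set.Ioo a b, (c r : E3) 1 = R r * Real.sin (θ r))
    (hs0 : HasConstSign (fun r => (c r : E3) 0) a b)
    (hs1 : HasConstSign (fun r => (c r : E3) 1) a b) :
    ∃ K m : ℝ, ∀ r ∈ Set.Ioo a b, c r ∉ poles ∧ longitude (c r) = θ r + K ∧
      modHalfPi (longitude (c r)) = θ r + K - m := by
  have hp : ∀ r ∈ Set.Ioo a b, c r ∉ poles := by
    rintro r hr ⟨p0, p1⟩
    rw [h0 r hr] at p0
    rw [h1 r hr] at p1
    have e0 := (mul_eq_zero.1 p0).resolve_left (hR r hr).ne'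
    have e1 := (mul_eq_zero.1 p1).resolve_left (hR r hr).ne'
    have := Real.sin_sq_add_cos_sq (θ r)
    rw [e0, e1] at this
    norm_num at this
  obtain ⟨j, hj⟩ := exists_floor_longitude hs0 hs1 hp
  have hcont := continuousOn_longitude hc hs0 hs1 hp
  have hint : ∀ r ∈ Set.Ioo a b, ∃ n : ℤ, (n : ℝ) * (2 * Real.pi) = longitude (c r) - θ r := by
    intro r hr
    obtain ⟨e1, e2⟩ := longitude_cos_sin (c r) (hR r hr) (h0 r hr) (h1 r hr)
    apply (Real.cos_eq_one_iff _).1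
    rw [Real.cos_sub, e1, e2]
    linear_combination Real.sin_sq_add_cos_sq (θ r)
  choose! n hn using hint
  -- A continuous integer-valued function on an interval is constant, so one multiple of `2π` serves
  -- the whole arc.
  have hnc : ContinuousOn n (Set.Ioo a b) := by
    rw [Int.isClosedEmbedding_coe_real.isInducing.continuousOn_iff]
    refine ((hcont.sub hθ).div_const (2 * Real.pi)).congr fun r hr => ?_
    have := hn r hr
    simp only [Function.comp, Pi.sub_apply, ← this]
    field_simp
  rcases (Set.Ioo a b).eq_empty_or_nonempty with he | ⟨x, hx⟩
  · exact ⟨0, 0, fun r hr => by simp [he] at hr⟩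
  refine ⟨n x * (2 * Real.pi), Real.pi / 2 * j, fun r hr => ?_⟩
  have e : longitude (c r) = θ r + n x * (2 * Real.pi) := by
    rw [isPreconnected_Ioo.constant hnc hx hr, hn r hr]; ring
  exact ⟨hp r hr, e, by rw [modHalfPi, hj r hr, e]⟩

/-! ### Convex graphs. -/

theorem exists_convex_graph_mem_frontier {J : Set ℝ} {h : ℝ → ℝ}
    (hh : ConvexOn ℝ J h ∨ ConcaveOn ℝ J h) {α β γ δ κ : ℝ} (hγ : γ ≠ 0) (hκ : κ ≠ 0) :
    ∃ A : Set (ℝ × ℝ), Convex ℝ A ∧ ∀ s ∈ J, (α + β * s + γ * h s, δ + κ * s) ∈ frontier A := by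
  wlog hconv : ConvexOn ℝ J h generalizing h γ
  · obtain ⟨A, hA, hAf⟩ := this (h := fun s => -h s) (γ := -γ)
      (Or.inl ((hh.resolve_left hconv).neg)) (neg_ne_zero.2 hγ) (hh.resolve_left hconv).neg
    exact ⟨A, hA, fun s hs => by simpa using hAf s hs⟩
  -- The epigraph of `h`, transported by the invertible affine map `(s, y) ↦ (α + β s + γ y, δ + κ
  -- s)`.
  refine ⟨{x | (x.2 - δ) / κ ∈ J ∧
    h ((x.2 - δ) / κ) ≤ (x.1 - α - β * ((x.2 - δ) / κ)) / γ}, ?_, ?_⟩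
  · intro x hx y hy m n hm hn hmn
    have e : ((m • x + n • y).2 - δ) / κ = m • ((x.2 - δ) / κ) + n • ((y.2 - δ) / κ) := by
      simp only [Prod.snd_add, Prod.smul_snd, smul_eq_mul]
      field_simp
      linear_combination (δ) * hmn
    have e1 : ((m • x + n • y).1 - α - β * (m • ((x.2 - δ) / κ) + n • ((y.2 - δ) / κ))) / γ =
        m • ((x.1 - α - β * ((x.2 - δ) / κ)) / γ) + n • ((y.1 - α - β * ((y.2 - δ) / κ)) / γ) := by
      generalize (x.2 - δ) / κ = u
      generalize (y.2 - δ) / κ = v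
      simp only [Prod.fst_add, Prod.smul_fst, smul_eq_mul]
      field_simp
      linear_combination α * hmn
    refine ⟨?_, ?_⟩
    · rw [e]; exact hconv.1 hx.1 hy.1 hm hn hmn
    · rw [e, e1]
      refine (hconv.2 hx.1 hy.1 hm hn hmn).trans ?_
      gcongr
      · exact hx.2
      · exact hy.2
  · intro s hs
    have e : (δ + κ * s - δ) / κ = s := by field_simp; ring
    rw [frontier_eq_closure_inter_closure]
    refine ⟨subset_closure ⟨?_, ?_⟩, ?_⟩
    · simpa only [e] using hs
    · simp only [e]
      apply le_of_eq
      field_simp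
      ring
    -- Points just below the graph lie outside the epigraph and converge to it.
    · have hlim : Filter.Tendsto (fun x : ℝ => (α + β * s + γ * (h s - x), δ + κ * s))
          (nhdsWithin 0 (Set.Ioi 0)) (nhds (α + β * s + γ * h s, δ + κ * s)) := by
        have hc : Continuous fun x : ℝ => (α + β * s + γ * (h s - x), δ + κ * s) := by fun_prop
        have := hc.tendsto 0
        simp only [sub_zero] at this
        exact this.mono_left nhdsWithin_le_nhds
      refine mem_closure_of_tendsto hlim ?_
      filter_upwards [self_mem_nhdsWithin] with x hx
      rintro ⟨-, h2⟩
      simp only [e] at h2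
      have e3 : (α + β * s + γ * (h s - x) - α - β * s) / γ = h s - x := by field_simp; ring
      rw [e3] at h2
      have : 0 < x := hx
      linarith

/-- Interior points of the image come from interior parameters, by monotonicity and the intermediate
value theorem. Hence continuity suffices at the ends, where the derivative of the azimuth may blow
up. -/
theorem convexOn_or_concaveOn_image {S h h' h'' : ℝ → ℝ} {a b : ℝ} (hab : a < b)
    (hS : ContinuousOn S (Set.Icc a b))
    (hmono : MonotoneOn S (Set.Icc a b) ∨ AntitoneOn S (Set.Icc a b))
    (hh : ContinuousOn h (S '' Set.Icc a b))
    (h1 : ∀ r ∈ Set.Ioo a b, HasDerivAt h (h' (S r)) (S r))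
    (h2 : ∀ r ∈ Set.Ioo a b, HasDerivAt h' (h'' (S r)) (S r))
    (hsign : (∀ r ∈ Set.Ioo a b, 0 ≤ h'' (S r)) ∨ ∀ r ∈ Set.Ioo a b, h'' (S r) ≤ 0) :
    ConvexOn ℝ (S '' Set.Icc a b) h ∨ ConcaveOn ℝ (S '' Set.Icc a b) h := by
  have ha : a ∈ Set.Icc a b := ⟨le_rfl, hab.le⟩
  have hb : b ∈ Set.Icc a b := ⟨hab.le, le_rfl⟩
  have hJ : Convex ℝ (S '' Set.Icc a b) :=
    ((isPreconnected_Icc.image S hS).ordConnected).convex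
  have hint : interior (S '' Set.Icc a b) ⊆ S '' Set.Ioo a b := by
    rcases hmono with hm | hm
    · have hsub : S '' Set.Icc a b ⊆ Set.Icc (S a) (S b) := by
        rintro _ ⟨r, hr, rfl⟩
        exact ⟨hm ha hr hr.1, hm hr hb hr.2⟩
      have := interior_mono hsub
      rw [interior_Icc] at this
      exact this.trans (intermediate_value_Ioo hab.le hS)
    · have hsub : S '' Set.Icc a b ⊆ Set.Icc (S b) (S a) := by
        rintro _ ⟨r, hr, rfl⟩
        exact ⟨hm hr hb hr.2, hm ha hr hr.1⟩
      have := interior_mono hsub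
      rw [interior_Icc] at this
      exact this.trans (intermediate_value_Ioo' hab.le hS)
  have d1 : ∀ x ∈ interior (S '' Set.Icc a b),
      HasDerivWithinAt h (h' x) (interior (S '' Set.Icc a b)) x := by
    intro x hx
    obtain ⟨r, hr, rfl⟩ := hint hx
    exact (h1 r hr).hasDerivWithinAt
  have d2 : ∀ x ∈ interior (S '' Set.Icc a b),
      HasDerivWithinAt h' (h'' x) (interior (S '' Set.Icc a b)) x := by
    intro x hx
    obtain ⟨r, hr, rfl⟩ := hint hx
    exact (h2 r hr).hasDerivWithinAt
  rcases hsign with hs | hs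
  · refine Or.inl (convexOn_of_hasDerivWithinAt2_nonneg hJ hh d1 d2 fun x hx => ?_)
    obtain ⟨r, hr, rfl⟩ := hint hx
    exact hs r hr
  · refine Or.inr (concaveOn_of_hasDerivWithinAt2_nonpos hJ hh d1 d2 fun x hx => ?_)
    obtain ⟨r, hr, rfl⟩ := hint hx
    exact hs r hr

theorem isConvexGap_of_graph {c : ℝ → S2} {S h : ℝ → ℝ} {a b α β γ δ κ : ℝ}
    (hS : ContinuousOn S (Set.Icc a b)) (hh : ContinuousOn h (S '' Set.Icc a b))
    (hconv : ConvexOn ℝ (S '' Set.Icc a b) h ∨ ConcaveOn ℝ (S '' Set.Icc a b) h)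
    (hγ : γ ≠ 0) (hκ : κ ≠ 0)
    (heq : ∀ r ∈ Set.Ioo a b, c r ∉ poles ∧
      healpixProj (c r) = (α + β * S r + γ * h (S r), δ + κ * S r)) :
    IsConvexGap c a b := by
  obtain ⟨A, hA, hAf⟩ := exists_convex_graph_mem_frontier hconv (α := α) (β := β) (δ := δ) hγ hκ
  refine ⟨fun r => (α + β * S r + γ * h (S r), δ + κ * S r), ?_, ⟨A, hA, ?_⟩, heq⟩
  · have := hh.comp hS (Set.mapsTo_image _ _)
    exact ((continuousOn_const.add (continuousOn_const.mul hS)).add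
      (continuousOn_const.mul this)).prodMk (continuousOn_const.add (continuousOn_const.mul hS))
  · rintro _ ⟨r, hr, rfl⟩
    exact hAf _ (Set.mem_image_of_mem S hr)

theorem azimuth_convexOn_or_concaveOn {p q t a b : ℝ} {Z : ℝ → ℝ} (hp : 0 < p)
    (hpq : p ^ 2 + q ^ 2 = 1) (hab : a < b) (hZ : Continuous Z)
    (hmono : MonotoneOn Z (Set.Icc a b) ∨ AntitoneOn Z (Set.Icc a b))
    (hZ1 : ∀ r, Z r ∈ Set.Icc (-1 : ℝ) 1) (hD : ∀ r, 0 ≤ capDisc p q t (Z r))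
    (hZ2 : ∀ r ∈ Set.Ioo a b, Z r ^ 2 < 1) (hD2 : ∀ r ∈ Set.Ioo a b, 0 < capDisc p q t (Z r))
    (hI : HasConstSign (fun r => equatorialInflection p q t (Z r)) a b) :
    ContinuousOn (azimuth p q t) (Z '' Set.Icc a b) ∧
    (ConvexOn ℝ (Z '' Set.Icc a b) (azimuth p q t) ∨
      ConcaveOn ℝ (Z '' Set.Icc a b) (azimuth p q t)) := by
  have hc : ContinuousOn (azimuth p q t) (Z '' Set.Icc a b) := by
    rintro _ ⟨r, -, rfl⟩
    refine (continuousWithinAt_azimuth hp hpq (hZ1 r) (hD r)).mono ?_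
    rintro _ ⟨s, -, rfl⟩
    exact hZ1 s
  refine ⟨hc, convexOn_or_concaveOn_image
    (h' := fun z => (q - t * z) / ((1 - z ^ 2) * √(capDisc p q t z)))
    (h'' := fun z => equatorialInflection p q t z /
        ((1 - z ^ 2) ^ 2 * (capDisc p q t z * √(capDisc p q t z))))
    hab hZ.continuousOn hmono hc
    (fun r hr => hasDerivAt_azimuth hp hpq (hZ2 r hr) (hD2 r hr))
    (fun r hr => hasDerivAt_azimuth_deriv (hZ2 r hr) (hD2 r hr)) ?_⟩
  have hden : ∀ r ∈ Set.Ioo a b, 0 ≤ (1 - Z r ^ 2) ^ 2 *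
      (capDisc p q t (Z r) * √(capDisc p q t (Z r))) := fun r hr => by
    have := hD r
    positivity
  rcases hI with h | h | h
  · exact Or.inl fun r hr => div_nonneg (h r hr).le (hden r hr)
  · exact Or.inr fun r hr => div_nonpos_of_nonpos_of_nonneg (h r hr).le (hden r hr)
  · exact Or.inl fun r hr => div_nonneg (h r hr).ge (hden r hr)

theorem polar_convexOn_or_concaveOn {p q t a b : ℝ} {Z : ℝ → ℝ} (hp : 0 < p)
    (hpq : p ^ 2 + q ^ 2 = 1) (hab : a < b) (hZ : Continuous Z)
    (hmono : MonotoneOn Z (Set.Icc a b) ∨ AntitoneOn Z (Set.Icc a b))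
    (hZ1 : ∀ r, Z r ∈ Set.Icc (-1 : ℝ) 1) (hD : ∀ r, 0 ≤ capDisc p q t (Z r))
    (hZ2 : ∀ r ∈ Set.Ioo a b, Z r ^ 2 < 1) (hD2 : ∀ r ∈ Set.Ioo a b, 0 < capDisc p q t (Z r))
    (hI : HasConstSign (fun r => polarInflection p q t (Z r)) a b) :
    ContinuousOn (fun s => s * azimuth p q t (1 - s ^ 2 / 3))
      ((fun r => √(1 - Z r) * √3) '' Set.Icc a b) ∧
    (ConvexOn ℝ ((fun r => √(1 - Z r) * √3) '' Set.Icc a b)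
        (fun s => s * azimuth p q t (1 - s ^ 2 / 3)) ∨
      ConcaveOn ℝ ((fun r => √(1 - Z r) * √3) '' Set.Icc a b)
        (fun s => s * azimuth p q t (1 - s ^ 2 / 3))) := by
  set S : ℝ → ℝ := fun r => √(1 - Z r) * √3 with hSdef
  have hS0 (r) : 0 ≤ S r := by positivity
  have hSZ (r) : 1 - S r ^ 2 / 3 = Z r := by
    simp only [hSdef]
    rw [mul_pow, Real.sq_sqrt (by linarith [(hZ1 r).2]), Real.sq_sqrt (by norm_num)]
    ring
  have hSc : Continuous S := by fun_prop
  have hle {x y : ℝ} (h : Z x ≤ Z y) : S y ≤ S x :=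
    mul_le_mul_of_nonneg_right (Real.sqrt_le_sqrt (by linarith)) (Real.sqrt_nonneg 3)
  have hSm : MonotoneOn S (Set.Icc a b) ∨ AntitoneOn S (Set.Icc a b) := by
    rcases hmono with h | h
    · exact Or.inr fun x hx y hy hxy => hle (h hx hy hxy)
    · exact Or.inl fun x hx y hy hxy => hle (h hx hy hxy)
  have hc : ContinuousOn (fun s => s * azimuth p q t (1 - s ^ 2 / 3)) (S '' Set.Icc a b) := by
    rintro _ ⟨r, -, rfl⟩
    refine continuousWithinAt_id.mul ?_
    have h1 := continuousWithinAt_azimuth hp hpq (hZ1 r) (hD r)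
    rw [← hSZ r] at h1
    refine h1.comp (f := fun s : ℝ => 1 - s ^ 2 / 3)
      (Continuous.continuousWithinAt (by fun_prop)) ?_
    rintro _ ⟨s, -, rfl⟩
    simp only [hSZ]
    exact hZ1 s
  refine ⟨hc, convexOn_or_concaveOn_image (S := S)
    (h' := fun s => azimuth p q t (1 - s ^ 2 / 3) - 2 * s ^ 2 / 3 * ((q - t * (1 - s ^ 2 / 3)) /
        ((1 - (1 - s ^ 2 / 3) ^ 2) * √(capDisc p q t (1 - s ^ 2 / 3)))))
    (h'' := fun s => 2 * s * (1 - (1 - s ^ 2 / 3)) / ((1 - (1 - s ^ 2 / 3) ^ 2) ^ 2 *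
      (capDisc p q t (1 - s ^ 2 / 3) * √(capDisc p q t (1 - s ^ 2 / 3)))) *
        polarInflection p q t (1 - s ^ 2 / 3)) hab hSc.continuousOn hSm hc
    (fun r hr => hasDerivAt_polar hp hpq (hSZ r) (hZ2 r hr) (hD2 r hr))
    (fun r hr => ?_) ?_⟩
  · have := hasDerivAt_polar_deriv hp hpq (hSZ r) (hZ2 r hr) (hD2 r hr)
    simpa only [hSZ r] using this
  · simp only [hSZ]
    have hcoef : ∀ r ∈ Set.Ioo a b, 0 ≤ 2 * S r * (1 - Z r) / ((1 - Z r ^ 2) ^ 2 *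
        (capDisc p q t (Z r) * √(capDisc p q t (Z r)))) := fun r hr => by
      have h1 := hD r
      have h2 := hS0 r
      have h3 : 0 ≤ 1 - Z r := by linarith [(hZ1 r).2]
      positivity
    rcases hI with h | h | h
    · exact Or.inl fun r hr => mul_nonneg (hcoef r hr) (h r hr).le
    · exact Or.inr fun r hr => mul_nonpos_of_nonneg_of_nonpos (hcoef r hr) (h r hr).le
    · exact Or.inl fun r hr => mul_nonneg (hcoef r hr) (h r hr).ge

/-! ### The boundary circle of a cap. -/

theorem exists_cos_sin_eq {x y : ℝ} (h : x ^ 2 + y ^ 2 = 1) :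
    ∃ θ, Real.cos θ = x ∧ Real.sin θ = y := by
  have hn : ‖(⟨x, y⟩ : ℂ)‖ = 1 := by
    rw [Complex.norm_def, Complex.normSq_mk, ← sq, ← sq, h, Real.sqrt_one]
  have h0 : (⟨x, y⟩ : ℂ) ≠ 0 := by rw [← norm_pos_iff, hn]; exact one_pos
  exact ⟨Complex.arg ⟨x, y⟩, by rw [Complex.cos_arg h0, hn, div_one],
    by rw [Complex.sin_arg, hn, div_one]⟩

theorem S2_sq_add_sq (x : S2) : (x : E3) 0 ^ 2 + (x : E3) 1 ^ 2 + (x : E3) 2 ^ 2 = 1 := by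
  have h : ‖(x : E3)‖ = 1 := norm_eq_of_mem_sphere x
  have := EuclideanSpace.real_norm_sq_eq (x : E3)
  rw [h, Fin.sum_univ_three] at this
  linarith

theorem mem_S2_iff (x : E3) : x ∈ Metric.sphere (0 : E3) 1 ↔ x 0 ^ 2 + x 1 ^ 2 + x 2 ^ 2 = 1 := by
  rw [mem_sphere_zero_iff_norm, ← pow_left_inj₀ (norm_nonneg _) zero_le_one two_ne_zero,
    EuclideanSpace.real_norm_sq_eq, Fin.sum_univ_three, one_pow]

theorem inner_E3 (x y : E3) : inner ℝ x y = x 0 * y 0 + x 1 * y 1 + x 2 * y 2 := by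
  simp [PiLp.inner_apply, Fin.sum_univ_three]
  ring

theorem capBoundary_eq (w : S2) {t : ℝ} (ht : t ∈ Set.Ioo (-1 : ℝ) 1) :
    capBoundary w t = {x : S2 | inner ℝ (x : E3) (w : E3) = t} := by
  apply Set.Subset.antisymm
  · intro x hx
    have hc : Continuous fun x : S2 => inner ℝ (x : E3) (w : E3) := by fun_prop
    have := frontier_le_subset_eq continuous_const hc hx
    exact this.symm
  · intro x hx
    have hx : inner ℝ (x : E3) (w : E3) = t := hx
    have hw1 : inner ℝ (w : E3) (w : E3) = 1 := by
      rw [real_inner_self_eq_norm_sq, norm_eq_of_mem_sphere w, one_pow]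
    have hx1 : inner ℝ (x : E3) (x : E3) = 1 := by
      rw [real_inner_self_eq_norm_sq, norm_eq_of_mem_sphere x, one_pow]
    have hρ : 0 < √(1 - t ^ 2) := Real.sqrt_pos.2 (by nlinarith [ht.1, ht.2])
    have hρ2 : √(1 - t ^ 2) ^ 2 = 1 - t ^ 2 := Real.sq_sqrt (by nlinarith [ht.1, ht.2])
    set ρ := √(1 - t ^ 2) with hρdef
    -- The unit vector orthogonal to `w` towards `x`. Following the great circle from `w` through
    -- `x` beyond `x` leaves the cap, so `x` is a limit of points outside it.
    obtain ⟨y, hy⟩ : ∃ y : E3, y = ρ⁻¹ • ((x : E3) - t • (w : E3)) := ⟨_, rfl⟩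
    have hyw : inner ℝ y (w : E3) = 0 := by
      rw [hy, inner_smul_left, inner_sub_left, inner_smul_left, hx, hw1]
      simp
    have hyy : inner ℝ y y = 1 := by
      rw [hy, inner_smul_left, inner_smul_right, inner_sub_left, inner_sub_right, inner_sub_right,
        inner_smul_left, inner_smul_left, inner_smul_right, inner_smul_right, hw1, hx1, hx,
        real_inner_comm, hx]
      simp only [conj_trivial]
      field_simp
      linarith
    have hmem (a : ℝ) : Real.cos a • (w : E3) + Real.sin a • y ∈ Metric.sphere (0 : E3) 1 := by
      rw [mem_sphere_zero_iff_norm, ← pow_left_inj₀ (norm_nonneg _) zero_le_one two_ne_zero,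
        ← real_inner_self_eq_norm_sq, inner_add_left, inner_add_right, inner_add_right,
        inner_smul_left, inner_smul_left, inner_smul_left, inner_smul_left, inner_smul_right,
        inner_smul_right, inner_smul_right, inner_smul_right, hw1, hyy, real_inner_comm, hyw]
      simp only [conj_trivial]
      linear_combination Real.sin_sq_add_cos_sq a
    let f : ℝ → S2 := fun a => ⟨Real.cos a • (w : E3) + Real.sin a • y, hmem a⟩
    have hf : Continuous f := by
      refine Continuous.subtype_mk ?_ _
      fun_prop
    have hfin (a : ℝ) : inner ℝ (f a : E3) (w : E3) = Real.cos a := by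
      simp only [f]
      rw [inner_add_left, inner_smul_left, inner_smul_left, hw1, hyw]
      simp
    have hfx : f (Real.arccos t) = x := by
      apply Subtype.ext
      simp only [f]
      rw [Real.cos_arccos ht.1.le ht.2.le, Real.sin_arccos, ← hρdef, hy, smul_smul,
        mul_inv_cancel₀ hρ.ne', one_smul]
      simp
    have hτ : Real.arccos t < Real.pi :=
      lt_of_le_of_ne (Real.arccos_le_pi t) fun h => by
        rw [Real.arccos_eq_pi] at h; linarith [ht.1]
    rw [capBoundary, frontier_eq_closure_inter_closure]
    refine ⟨subset_closure hx.ge, ?_⟩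
    have hlim : Filter.Tendsto f (nhdsWithin (Real.arccos t) (Set.Ioi (Real.arccos t)))
        (nhds x) := by
      have := hf.tendsto (Real.arccos t)
      rw [hfx] at this
      exact this.mono_left nhdsWithin_le_nhds
    refine mem_closure_of_tendsto hlim ?_
    filter_upwards [Ioo_mem_nhdsGT hτ] with a ha
    have h1 : Real.cos a < Real.cos (Real.arccos t) :=
      Real.strictAntiOn_cos ⟨Real.arccos_nonneg t, hτ.le⟩
        ⟨(Real.arccos_nonneg t).trans ha.1.le, ha.2.le⟩ ha.1
    rw [Real.cos_arccos ht.1.le ht.2.le] at h1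
    intro hcon
    have hcon : t ≤ inner ℝ (f a : E3) (w : E3) := hcon
    rw [hfin] at hcon
    linarith

theorem exists_horizontal_frame (w : S2) :
    ∃ p q u v : ℝ, 0 ≤ p ∧ p ^ 2 + q ^ 2 = 1 ∧ u ^ 2 + v ^ 2 = 1 ∧
      (w : E3) 0 = p * u ∧ (w : E3) 1 = p * v ∧ (w : E3) 2 = q := by
  have hw := S2_sq_add_sq w
  have hnn : 0 ≤ (w : E3) 0 ^ 2 + (w : E3) 1 ^ 2 := by positivity
  have hp2 := Real.sq_sqrt hnn
  set p := √((w : E3) 0 ^ 2 + (w : E3) 1 ^ 2) with hp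
  rcases eq_or_lt_of_le (Real.sqrt_nonneg ((w : E3) 0 ^ 2 + (w : E3) 1 ^ 2)) with h | h
  · rw [← hp] at h
    rw [← h] at hp2
    refine ⟨0, (w : E3) 2, 1, 0, le_rfl, ?_, by norm_num, ?_, ?_, rfl⟩
    · linarith
    · nlinarith [sq_nonneg ((w : E3) 0), sq_nonneg ((w : E3) 1)]
    · nlinarith [sq_nonneg ((w : E3) 0), sq_nonneg ((w : E3) 1)]
  · rw [← hp] at h
    refine ⟨p, (w : E3) 2, (w : E3) 0 / p, (w : E3) 1 / p, h.le, by linarith, ?_, ?_, ?_, rfl⟩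
    · rw [div_pow, div_pow, ← add_div, ← hp2]; field_simp
    · field_simp
    · field_simp

/-- A parametrization of the boundary circle of a cap, adapted to the axis of the sphere. -/
theorem exists_circle_param (w : S2) {t p q u v : ℝ} (ht : t ∈ Set.Ioo (-1 : ℝ) 1)
    (hpq : p ^ 2 + q ^ 2 = 1) (huv : u ^ 2 + v ^ 2 = 1)
    (hw0 : (w : E3) 0 = p * u) (hw1 : (w : E3) 1 = p * v) (hw2 : (w : E3) 2 = q) :
    ∃ (ρ : ℝ) (c : ℝ → S2), 0 < ρ ∧ ρ ^ 2 = 1 - t ^ 2 ∧ Continuous c ∧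
      Function.Periodic c (2 * Real.pi) ∧
      (∀ x, Set.BijOn c (Set.Ico x (x + 2 * Real.pi)) (capBoundary w t)) ∧
      ∀ r, (c r : E3) 0 = u * (t * p - ρ * q * Real.cos r) - v * (ρ * Real.sin r) ∧
        (c r : E3) 1 = v * (t * p - ρ * q * Real.cos r) + u * (ρ * Real.sin r) ∧
        (c r : E3) 2 = t * q + ρ * p * Real.cos r := by
  have hρ : 0 < √(1 - t ^ 2) := Real.sqrt_pos.2 (by nlinarith [ht.1, ht.2])
  have hρ2 : √(1 - t ^ 2) ^ 2 = 1 - t ^ 2 := Real.sq_sqrt (by nlinarith [ht.1, ht.2])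
  set ρ := √(1 - t ^ 2)
  have hmem (r : ℝ) : (!₂[u * (t * p - ρ * q * Real.cos r) - v * (ρ * Real.sin r),
      v * (t * p - ρ * q * Real.cos r) + u * (ρ * Real.sin r),
      t * q + ρ * p * Real.cos r] : E3) ∈ Metric.sphere (0 : E3) 1 := by
    rw [mem_S2_iff]
    simp only [Matrix.cons_val_zero, Matrix.cons_val_one, Matrix.cons_val]
    linear_combination ((t * p - ρ * q * Real.cos r) ^ 2 + (ρ * Real.sin r) ^ 2) * huv +
      (t ^ 2 + ρ ^ 2 * Real.cos r ^ 2) * hpq + hρ2 + ρ ^ 2 * Real.sin_sq_add_cos_sq r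
  -- This is `t w + ρ (cos r • e + sin r • f)` with the orthonormal basis `e = (-q u, -q v, p)`, `f
  -- = (-v, u, 0)` of the plane orthogonal to `w`.
  let c : ℝ → S2 := fun r => ⟨_, hmem r⟩
  have hc0 (r) : (c r : E3) 0 = u * (t * p - ρ * q * Real.cos r) - v * (ρ * Real.sin r) := rfl
  have hc1 (r) : (c r : E3) 1 = v * (t * p - ρ * q * Real.cos r) + u * (ρ * Real.sin r) := rfl
  have hc2 (r) : (c r : E3) 2 = t * q + ρ * p * Real.cos r := rfl
  refine ⟨ρ, c, hρ, hρ2, ?_, ?_, fun x => ⟨?_, ?_, ?_⟩, fun r => ⟨hc0 r, hc1 r, hc2 r⟩⟩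
  · refine Continuous.subtype_mk ?_ _
    fun_prop
  · intro r
    apply Subtype.ext
    simp only [c, Real.cos_add_two_pi, Real.sin_add_two_pi]
  · intro r _
    rw [capBoundary_eq w ht, Set.mem_ofPred_eq, inner_E3, hc0, hc1, hc2, hw0, hw1, hw2]
    linear_combination p * (t * p - ρ * q * Real.cos r) * huv + t * hpq
  · intro r hr s hs hrs
    have e0 : (c r : E3) 0 = (c s : E3) 0 := by rw [hrs]
    have e1 : (c r : E3) 1 = (c s : E3) 1 := by rw [hrs]
    have e2 : (c r : E3) 2 = (c s : E3) 2 := by rw [hrs]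
    rw [hc0, hc0] at e0
    rw [hc1, hc1] at e1
    rw [hc2, hc2] at e2
    have hsin : Real.sin r = Real.sin s := by
      have : ρ * (Real.sin r - Real.sin s) = 0 := by
        linear_combination u * e1 - v * e0 - (ρ * (Real.sin r - Real.sin s)) * huv
      linarith [(mul_eq_zero.1 this).resolve_left hρ.ne']
    have hcos : Real.cos r = Real.cos s := by
      have : ρ * (Real.cos r - Real.cos s) = 0 := by
        linear_combination -q * (u * e0 + v * e1) + p * e2 -
          (ρ * (Real.cos r - Real.cos s)) * hpq -
          q ^ 2 * (ρ * (Real.cos r - Real.cos s)) * huv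
      linarith [(mul_eq_zero.1 this).resolve_left hρ.ne']
    have h1 : Real.cos (r - s) = 1 := by
      rw [Real.cos_sub, hsin, hcos]
      linear_combination Real.sin_sq_add_cos_sq s
    rw [Real.cos_eq_one_iff_of_lt_of_lt (by linarith [hr.1, hs.2]) (by linarith [hr.2, hs.1])] at h1
    linarith
  · intro y hy
    rw [capBoundary_eq w ht, Set.mem_ofPred_eq, inner_E3, hw0, hw1, hw2] at hy
    have hy1 := S2_sq_add_sq y
    set a := u * (y : E3) 0 + v * (y : E3) 1 with ha
    set b := -v * (y : E3) 0 + u * (y : E3) 1 with hb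
    have hab : a ^ 2 + b ^ 2 + (y : E3) 2 ^ 2 = 1 := by
      rw [ha, hb]
      linear_combination hy1 + ((y : E3) 0 ^ 2 + (y : E3) 1 ^ 2) * huv
    have hat : p * a + q * (y : E3) 2 = t := by rw [ha]; linear_combination hy
    have hunit : ((-q * a + p * (y : E3) 2) / ρ) ^ 2 + (b / ρ) ^ 2 = 1 := by
      field_simp
      rw [hρ2]
      linear_combination hab + (a ^ 2 + (y : E3) 2 ^ 2) * hpq -
        (p * a + q * (y : E3) 2 + t) * hat
    obtain ⟨θ, hθc, hθs⟩ := exists_cos_sin_eq hunit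
    have hper : Function.Periodic (fun r => (Real.cos r, Real.sin r)) (2 * Real.pi) := fun r => by
      simp
    obtain ⟨r, hr, hrθ⟩ := hper.exists_mem_Ico Real.two_pi_pos θ x
    simp only [Prod.mk.injEq] at hrθ
    have hrc : ρ * Real.cos r = -q * a + p * (y : E3) 2 := by rw [← hrθ.1, hθc]; field_simp
    have hrs : ρ * Real.sin r = b := by rw [← hrθ.2, hθs]; field_simp
    refine ⟨r, hr, ?_⟩
    have hX : t * p - ρ * q * Real.cos r = a := by
      linear_combination -q * hrc - p * hat + a * hpq
    apply Subtype.ext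
    ext i
    fin_cases i
    · change (c r : E3) 0 = (y : E3) 0
      rw [hc0, hX, hrs, ha, hb]
      linear_combination (y : E3) 0 * huv
    · change (c r : E3) 1 = (y : E3) 1
      rw [hc1, hX, hrs, ha, hb]
      linear_combination (y : E3) 1 * huv
    · change (c r : E3) 2 = (y : E3) 2
      rw [hc2]
      linear_combination p * hrc + q * hat * (-1) + (y : E3) 2 * hpq

/-! ### Projected arcs. -/

theorem healpixProj_of_abs_le {x : S2} (h : |(x : E3) 2| ≤ 2 / 3) :
    healpixProj x = (longitude x / Real.pi, 3 / 8 * (x : E3) 2) := by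
  simp only [healpixProj, if_pos h]

theorem healpixProj_of_lt {x : S2} (h : 2 / 3 < (x : E3) 2) :
    healpixProj x =
      (1 / Real.pi * (longitude x - (1 - √(1 - (x : E3) 2) * √3) *
        (modHalfPi (longitude x) - Real.pi / 4)),
      1 / Real.pi * (Real.pi / 4 * (2 - √(1 - (x : E3) 2) * √3))) := by
  have h' : ¬ |(x : E3) 2| ≤ 2 / 3 := not_le.2 (h.trans_le (le_abs_self _))
  simp only [healpixProj, if_neg h', if_pos h]

theorem healpixProj_of_lt_neg {x : S2} (h : (x : E3) 2 < -(2 / 3)) :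
    healpixProj x =
      (1 / Real.pi * (longitude x - (1 - √(1 - -(x : E3) 2) * √3) *
        (modHalfPi (longitude x) - Real.pi / 4)),
      1 / Real.pi * (Real.pi / 4 * (√(1 - -(x : E3) 2) * √3 - 2))) := by
  have e : |(x : E3) 2| = -(x : E3) 2 := abs_of_neg (by linarith)
  have h' : ¬ |(x : E3) 2| ≤ 2 / 3 := by rw [e]; linarith
  have h'' : ¬ 2 / 3 < (x : E3) 2 := by linarith
  simp only [healpixProj, if_neg h', if_neg h'']
  rw [e]

/-- Here `X`, `Y` are the horizontal coordinates along and across the direction of `w`; the cap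
equation gives `X`, and the sign `ε` of `Y` selects the branch of `arccos`. -/
theorem polarCoord_azimuth {p q t z X Y ε : ℝ} (hp : 0 < p) (hXY : X ^ 2 + Y ^ 2 = 1 - z ^ 2)
    (hX : t - q * z = p * X) (hε : ε = 1 ∨ ε = -1) (hY : 0 < ε * Y) :
    √(1 - z ^ 2) * Real.cos (ε * azimuth p q t z) = X ∧
      √(1 - z ^ 2) * Real.sin (ε * azimuth p q t z) = Y := by
  have hY0 : Y ≠ 0 := by rintro rfl; simp at hY
  have hpos : 0 < 1 - z ^ 2 := by rw [← hXY]; positivity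
  have hR : 0 < √(1 - z ^ 2) := Real.sqrt_pos.2 hpos
  have hR2 : √(1 - z ^ 2) ^ 2 = 1 - z ^ 2 := Real.sq_sqrt hpos.le
  have hA : azimuth p q t z = Real.arccos (X / √(1 - z ^ 2)) := by
    rw [azimuth, hX, mul_div_mul_left _ _ hp.ne']
  rw [hA]
  set R := √(1 - z ^ 2)
  have hXR : |X| ≤ R := abs_le_of_sq_le_sq (by nlinarith [sq_nonneg Y]) hR.le
  have hcos : Real.cos (Real.arccos (X / R)) = X / R := by
    apply Real.cos_arccos
    · rw [le_div_iff₀ hR]; linarith [(abs_le.1 hXR).1]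
    · rw [div_le_iff₀ hR]; linarith [(abs_le.1 hXR).2]
  have hsin : Real.sin (Real.arccos (X / R)) = ε * Y / R := by
    rw [Real.sin_arccos]
    have : 1 - (X / R) ^ 2 = (ε * Y / R) ^ 2 := by
      rcases hε with rfl | rfl <;> field_simp <;> linarith
    rw [this, Real.sqrt_sq (by positivity)]
  rcases hε with rfl | rfl
  · rw [one_mul, hcos, hsin]
    constructor <;> field_simp
  · rw [neg_one_mul, Real.cos_neg, Real.sin_neg, hcos, hsin]
    constructor <;> field_simp

theorem monotoneOn_or_antitoneOn_height {h k a b : ℝ} (hsin : HasConstSign Real.sin a b) :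
    MonotoneOn (fun r => h + k * Real.cos r) (Set.Icc a b) ∨
      AntitoneOn (fun r => h + k * Real.cos r) (Set.Icc a b) := by
  have hcos : MonotoneOn Real.cos (Set.Icc a b) ∨ AntitoneOn Real.cos (Set.Icc a b) := by
    rcases hsin with h | h | h
    · refine Or.inr (antitoneOn_of_deriv_nonpos (convex_Icc a b) Real.continuous_cos.continuousOn
        Real.differentiable_cos.differentiableOn fun x hx => ?_)
      rw [interior_Icc] at hx
      rw [Real.deriv_cos]
      linarith [h x hx]
    · refine Or.inl (monotoneOn_of_deriv_nonneg (convex_Icc a b) Real.continuous_cos.continuousOn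
        Real.differentiable_cos.differentiableOn fun x hx => ?_)
      rw [interior_Icc] at hx
      rw [Real.deriv_cos]
      linarith [h x hx]
    · refine Or.inl (monotoneOn_of_deriv_nonneg (convex_Icc a b) Real.continuous_cos.continuousOn
        Real.differentiable_cos.differentiableOn fun x hx => ?_)
      rw [interior_Icc] at hx
      rw [Real.deriv_cos]
      linarith [h x hx]
  rcases hcos with hm | hm <;> rcases le_total 0 k with hk | hk
  · exact Or.inl fun x hx y hy hxy => by have := hm hx hy hxy; dsimp only; nlinarith
  · exact Or.inr fun x hx y hy hxy => by have := hm hx hy hxy; dsimp only; nlinarith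
  · exact Or.inr fun x hx y hy hxy => by have := hm hx hy hxy; dsimp only; nlinarith
  · exact Or.inl fun x hx y hy hxy => by have := hm hx hy hxy; dsimp only; nlinarith

theorem isConvexGap_of_pos {c : ℝ → S2} {p q u v t ρ a b : ℝ} (hp : 0 < p)
    (hpq : p ^ 2 + q ^ 2 = 1) (huv : u ^ 2 + v ^ 2 = 1) (hρ : 0 < ρ) (hρt : ρ ^ 2 = 1 - t ^ 2)
    (hc : Continuous c)
    (hc0 : ∀ r, (c r : E3) 0 = u * (t * p - ρ * q * Real.cos r) - v * (ρ * Real.sin r))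
    (hc1 : ∀ r, (c r : E3) 1 = v * (t * p - ρ * q * Real.cos r) + u * (ρ * Real.sin r))
    (hc2 : ∀ r, (c r : E3) 2 = t * q + ρ * p * Real.cos r) (hab : a < b)
    (hsin : (∀ r ∈ Set.Ioo a b, 0 < Real.sin r) ∨ ∀ r ∈ Set.Ioo a b, Real.sin r < 0)
    (hs0 : HasConstSign (fun r => (c r : E3) 0) a b)
    (hs1 : HasConstSign (fun r => (c r : E3) 1) a b)
    (hN : HasConstSign (fun r => (c r : E3) 2 - 2 / 3) a b)
    (hS : HasConstSign (fun r => (c r : E3) 2 + 2 / 3) a b)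
    (hIE : HasConstSign (fun r => equatorialInflection p q t ((c r : E3) 2)) a b)
    (hIN : HasConstSign (fun r => polarInflection p q t ((c r : E3) 2)) a b)
    (hIS : HasConstSign (fun r => polarInflection p (-q) t (-(c r : E3) 2)) a b) :
    IsConvexGap c a b := by
  obtain ⟨Z, hZdef⟩ : ∃ Z : ℝ → ℝ, Z = fun r => (c r : E3) 2 := ⟨_, rfl⟩
  have hcZ (r) : (c r : E3) 2 = Z r := by rw [hZdef]
  simp only [hcZ] at hN hS hIE hIN hIS
  have hZc : Continuous Z := by rw [hZdef]; fun_prop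
  have hZr (r) : Z r = t * q + ρ * p * Real.cos r := by rw [← hcZ, hc2]
  have hXY (r) : (t * p - ρ * q * Real.cos r) ^ 2 + (ρ * Real.sin r) ^ 2 = 1 - Z r ^ 2 := by
    rw [hZr]
    linear_combination (t ^ 2 + ρ ^ 2 * Real.cos r ^ 2) * hpq + hρt +
      ρ ^ 2 * Real.sin_sq_add_cos_sq r
  have hX (r) : t - q * Z r = p * (t * p - ρ * q * Real.cos r) := by
    rw [hZr]; linear_combination -t * hpq
  -- So the discriminant degenerates only where `sin r = 0`, at the highest and lowest points of the
  -- circle.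
  have hDr (r) : capDisc p q t (Z r) = (p * (ρ * Real.sin r)) ^ 2 := by
    rw [capDisc]
    linear_combination p ^ 2 * (-hXY r) + Z r ^ 2 * hpq -
      (t - q * Z r + p * (t * p - ρ * q * Real.cos r)) * hX r
  have hZ1 (r) : Z r ∈ Set.Icc (-1 : ℝ) 1 := by
    rw [Set.mem_Icc, ← abs_le, ← sq_le_one_iff_abs_le_one]
    nlinarith [hXY r, sq_nonneg (t * p - ρ * q * Real.cos r), sq_nonneg (ρ * Real.sin r)]
  have hD (r) : 0 ≤ capDisc p q t (Z r) := by rw [hDr]; positivity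
  have hsin0 : ∀ r ∈ Set.Ioo a b, Real.sin r ≠ 0 := fun r hr => by
    rcases hsin with h | h
    · exact (h r hr).ne'
    · exact (h r hr).ne
  have hZ2 : ∀ r ∈ Set.Ioo a b, Z r ^ 2 < 1 := fun r hr => by
    have : 0 < (ρ * Real.sin r) ^ 2 := by have := hsin0 r hr; positivity
    nlinarith [hXY r, sq_nonneg (t * p - ρ * q * Real.cos r)]
  have hD2 : ∀ r ∈ Set.Ioo a b, 0 < capDisc p q t (Z r) := fun r hr => by
    have := hsin0 r hr
    rw [hDr]; positivity
  have hsin' : HasConstSign Real.sin a b := by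
    rcases hsin with h | h
    · exact Or.inl h
    · exact Or.inr (Or.inl h)
  have hmono : MonotoneOn Z (Set.Icc a b) ∨ AntitoneOn Z (Set.Icc a b) := by
    have := monotoneOn_or_antitoneOn_height (h := t * q) (k := ρ * p) hsin'
    rwa [← funext hZr] at this
  obtain ⟨ε, hε, hεs⟩ : ∃ ε : ℝ, (ε = 1 ∨ ε = -1) ∧
      ∀ r ∈ Set.Ioo a b, 0 < ε * (ρ * Real.sin r) := by
    rcases hsin with h | h
    · exact ⟨1, Or.inl rfl, fun r hr => by rw [one_mul]; exact mul_pos hρ (h r hr)⟩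
    · exact ⟨-1, Or.inr rfl, fun r hr => by nlinarith [mul_pos_of_neg_of_neg (neg_lt_zero.2 hρ) (h r hr)]⟩
  obtain ⟨ψ, hψu, hψv⟩ := exists_cos_sin_eq huv
  obtain ⟨hAc, hAconv⟩ := azimuth_convexOn_or_concaveOn hp hpq hab hZc hmono hZ1 hD hZ2 hD2 hIE
  have hθ : ContinuousOn (fun r => ψ + ε * azimuth p q t (Z r)) (Set.Ioo a b) :=
    continuousOn_const.add (continuousOn_const.mul
      ((hAc.comp hZc.continuousOn (Set.mapsTo_image _ _)).mono Set.Ioo_subset_Icc_self))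
  obtain ⟨K, m, hKm⟩ := exists_longitude_eq hc (R := fun r => √(1 - Z r ^ 2)) hθ
    (fun r hr => Real.sqrt_pos.2 (by linarith [hZ2 r hr]))
    (fun r hr => by
      obtain ⟨e1, e2⟩ := polarCoord_azimuth hp (hXY r) (hX r) hε (hεs r hr)
      rw [hc0, Real.cos_add, hψu, hψv]
      linear_combination -u * e1 + v * e2)
    (fun r hr => by
      obtain ⟨e1, e2⟩ := polarCoord_azimuth hp (hXY r) (hX r) hε (hεs r hr)
      rw [hc1, Real.sin_add, hψu, hψv]
      linear_combination -v * e1 - u * e2) hs0 hs1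
  have hπ := Real.pi_ne_zero
  have hε0 : ε / Real.pi ≠ 0 := by
    refine div_ne_zero ?_ hπ
    rcases hε with rfl | rfl <;> norm_num
  have north (h : ∀ r ∈ Set.Ioo a b, 0 < Z r - 2 / 3) : IsConvexGap c a b := by
    obtain ⟨h1, h2⟩ := polar_convexOn_or_concaveOn hp hpq hab hZc hmono hZ1 hD hZ2 hD2 hIN
    -- With `φ = θ + K` and `φ mod π/2 = θ + K - m`, the first coordinate is `(m + π/4 + s (θ + K -
    -- m - π/4))/π`; substitute `θ = ψ + ε * azimuth`. The second is `1/2 - s/4`.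
    refine isConvexGap_of_graph (α := (m + Real.pi / 4) / Real.pi)
      (β := (ψ + K - m - Real.pi / 4) / Real.pi) (γ := ε / Real.pi) (δ := 1 / 2) (κ := -1 / 4)
      (Continuous.continuousOn (by fun_prop)) h1 h2 hε0 (by norm_num) fun r hr => ?_
    obtain ⟨k1, k2, k3⟩ := hKm r hr
    refine ⟨k1, ?_⟩
    have hs : 1 - (√(1 - Z r) * √3) ^ 2 / 3 = Z r := by
      rw [mul_pow, Real.sq_sqrt (by linarith [(hZ1 r).2]), Real.sq_sqrt (by norm_num)]; ring
    rw [healpixProj_of_lt (by rw [hcZ]; linarith [h r hr]), k3, k2, hcZ, hs]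
    generalize √(1 - Z r) * √3 = s
    ext
    · simp only; field_simp; ring
    · simp only; field_simp; ring
  have south (h : ∀ r ∈ Set.Ioo a b, Z r + 2 / 3 < 0) : IsConvexGap c a b := by
    -- The reflection `z ↦ -z`, `q ↦ -q` preserves `azimuth` and `capDisc`, reducing the south to
    -- the north.
    obtain ⟨h1, h2⟩ := polar_convexOn_or_concaveOn (q := -q) (t := t) (Z := fun r => -Z r) hp
      (by linarith) hab hZc.neg
      (hmono.symm.imp AntitoneOn.neg MonotoneOn.neg)
      (fun r => ⟨by linarith [(hZ1 r).2], by linarith [(hZ1 r).1]⟩)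
      (fun r => by rw [capDisc_neg]; exact hD r)
      (fun r hr => by rw [neg_sq]; exact hZ2 r hr)
      (fun r hr => by rw [capDisc_neg]; exact hD2 r hr) hIS
    refine isConvexGap_of_graph (α := (m + Real.pi / 4) / Real.pi)
      (β := (ψ + K - m - Real.pi / 4) / Real.pi) (γ := ε / Real.pi) (δ := -1 / 2) (κ := 1 / 4)
      (Continuous.continuousOn (by fun_prop)) h1 h2 hε0 (by norm_num) fun r hr => ?_
    obtain ⟨k1, k2, k3⟩ := hKm r hr
    refine ⟨k1, ?_⟩
    have hs : 1 - (√(1 - -Z r) * √3) ^ 2 / 3 = -Z r := by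
      rw [mul_pow, Real.sq_sqrt (by linarith [(hZ1 r).1]), Real.sq_sqrt (by norm_num)]; ring
    rw [healpixProj_of_lt_neg (by rw [hcZ]; linarith [h r hr]), k3, k2, hcZ, hs, azimuth_neg]
    generalize √(1 - -Z r) * √3 = s
    ext
    · simp only; field_simp; ring
    · simp only; field_simp; ring
  have equator (h : ∀ r ∈ Set.Ioo a b, |Z r| ≤ 2 / 3) : IsConvexGap c a b := by
    refine isConvexGap_of_graph (α := (ψ + K) / Real.pi) (β := 0) (γ := ε / Real.pi) (δ := 0)
      (κ := 3 / 8) hZc.continuousOn hAc hAconv hε0 (by norm_num) fun r hr => ?_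
    obtain ⟨k1, k2, -⟩ := hKm r hr
    refine ⟨k1, ?_⟩
    rw [healpixProj_of_abs_le (by rw [hcZ]; exact h r hr), k2, hcZ]
    ext
    · simp only; field_simp; ring
    · simp only; ring
  have hle : (∀ r ∈ Set.Ioo a b, 0 < Z r - 2 / 3) ∨ ∀ r ∈ Set.Ioo a b, Z r ≤ 2 / 3 := by
    rcases hN with h | h | h
    · exact Or.inl h
    · exact Or.inr fun r hr => by linarith [h r hr]
    · exact Or.inr fun r hr => by linarith [h r hr]
  have hge : (∀ r ∈ Set.Ioo a b, Z r + 2 / 3 < 0) ∨ ∀ r ∈ Set.Ioo a b, -(2 / 3) ≤ Z r := by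
    rcases hS with h | h | h
    · exact Or.inr fun r hr => by linarith [h r hr]
    · exact Or.inl h
    · exact Or.inr fun r hr => by linarith [h r hr]
  rcases hle with h | h
  · exact north h
  rcases hge with h' | h'
  · exact south h'
  · exact equator fun r hr => abs_le.2 ⟨h' r hr, h r hr⟩

/-- The height is constant, so the image lies on a horizontal line, the boundary of a half-plane. -/
theorem isConvexGap_of_parallel {c : ℝ → S2} {q u v t ρ a b : ℝ} (hq : q ^ 2 = 1)
    (huv : u ^ 2 + v ^ 2 = 1) (hρ : 0 < ρ) (hc : Continuous c)
    (hc0 : ∀ r, (c r : E3) 0 = u * (-(ρ * q * Real.cos r)) - v * (ρ * Real.sin r))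
    (hc1 : ∀ r, (c r : E3) 1 = v * (-(ρ * q * Real.cos r)) + u * (ρ * Real.sin r))
    (hc2 : ∀ r, (c r : E3) 2 = t * q)
    (hs0 : HasConstSign (fun r => (c r : E3) 0) a b)
    (hs1 : HasConstSign (fun r => (c r : E3) 1) a b) :
    IsConvexGap c a b := by
  obtain ⟨ψ, hψu, hψv⟩ := exists_cos_sin_eq huv
  obtain ⟨θ, hθ, h0, h1⟩ : ∃ θ : ℝ → ℝ, Continuous θ ∧
      (∀ r, (c r : E3) 0 = ρ * Real.cos (θ r)) ∧ ∀ r, (c r : E3) 1 = ρ * Real.sin (θ r) := by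
    rcases (show q = 1 ∨ q = -1 from by simpa using hq) with rfl | rfl
    · refine ⟨fun r => ψ + (Real.pi - r), by fun_prop, fun r => ?_, fun r => ?_⟩
      · rw [hc0, Real.cos_add, Real.cos_pi_sub, Real.sin_pi_sub, hψu, hψv]; ring
      · rw [hc1, Real.sin_add, Real.cos_pi_sub, Real.sin_pi_sub, hψu, hψv]; ring
    · refine ⟨fun r => ψ + r, by fun_prop, fun r => ?_, fun r => ?_⟩
      · rw [hc0, Real.cos_add, hψu, hψv]; ring
      · rw [hc1, Real.sin_add, hψu, hψv]; ring
  obtain ⟨K, m, hKm⟩ := exists_longitude_eq hc (R := fun _ => ρ) hθ.continuousOn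
    (fun _ _ => hρ) (fun r _ => h0 r) (fun r _ => h1 r) hs0 hs1
  obtain ⟨f, y, hf, hfy⟩ : ∃ (f : ℝ → ℝ) (y : ℝ), Continuous f ∧
      ∀ r ∈ Set.Ioo a b, healpixProj (c r) = (f r, y) := by
    rcases le_or_gt |t * q| (2 / 3) with h | h
    · refine ⟨fun r => (θ r + K) / Real.pi, 3 / 8 * (t * q), by fun_prop, fun r hr => ?_⟩
      rw [healpixProj_of_abs_le (by rwa [hc2]), hc2, (hKm r hr).2.1]
    · rcases lt_abs.1 h with h | h
      · refine ⟨fun r => 1 / Real.pi * (θ r + K - (1 - √(1 - t * q) * √3) *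
          (θ r + K - m - Real.pi / 4)),
          1 / Real.pi * (Real.pi / 4 * (2 - √(1 - t * q) * √3)), by fun_prop, fun r hr => ?_⟩
        rw [healpixProj_of_lt (by rwa [hc2]), hc2, (hKm r hr).2.2, (hKm r hr).2.1]
      · refine ⟨fun r => 1 / Real.pi * (θ r + K - (1 - √(1 - -(t * q)) * √3) *
          (θ r + K - m - Real.pi / 4)),
          1 / Real.pi * (Real.pi / 4 * (√(1 - -(t * q)) * √3 - 2)), by fun_prop, fun r hr => ?_⟩
        rw [healpixProj_of_lt_neg (by rw [hc2]; linarith), hc2, (hKm r hr).2.2, (hKm r hr).2.1]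
  refine ⟨fun r => (f r, y), Continuous.continuousOn (by fun_prop),
    ⟨Set.univ ×ˢ Set.Iic y, convex_univ.prod (convex_Iic y), ?_⟩,
    fun r hr => ⟨(hKm r hr).1, hfy r hr⟩⟩
  rintro _ ⟨r, -, rfl⟩
  rw [frontier_univ_prod_eq, frontier_Iic]
  exact ⟨trivial, rfl⟩

/-! ### Counting the special parameters. -/

theorem IsTrigPoly.capDisc {Z : ℝ → ℝ} (hZ : IsTrigPoly 1 Z) (p q t : ℝ) :
    IsTrigPoly 2 fun r => capDisc p q t (Z r) := by
  have := (((IsTrigPoly.const (p ^ 2 - t ^ 2)).mono zero_le_two).add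
    ((hZ.const_mul (2 * t * q)).mono one_le_two)).sub (hZ.mul hZ)
  convert this using 2
  rw [_root_.capDisc]; ring

theorem IsTrigPoly.one_sub_sq {Z : ℝ → ℝ} (hZ : IsTrigPoly 1 Z) :
    IsTrigPoly 2 fun r => 1 - Z r ^ 2 := by
  have := ((IsTrigPoly.const 1).mono zero_le_two).sub (hZ.mul hZ)
  convert this using 2
  ring

theorem IsTrigPoly.equatorialInflection {Z : ℝ → ℝ} (hZ : IsTrigPoly 1 Z) (p q t : ℝ) :
    IsTrigPoly 4 fun r => equatorialInflection p q t (Z r) := by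
  have h1 := (hZ.one_sub_sq.const_mul (-t)).mul (hZ.capDisc p q t)
  have h2 : IsTrigPoly 1 fun r => q - t * Z r :=
    ((IsTrigPoly.const q).mono zero_le_one).sub (hZ.const_mul t)
  have h3 : IsTrigPoly 1 fun r => t * q - Z r :=
    ((IsTrigPoly.const (t * q)).mono zero_le_one).sub hZ
  exact h1.add (h2.mul (((hZ.const_mul 2).mul (hZ.capDisc p q t)).sub (hZ.one_sub_sq.mul h3)))

theorem IsTrigPoly.polarInflection {Z : ℝ → ℝ} (hZ : IsTrigPoly 1 Z) (p q t : ℝ) :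
    IsTrigPoly 4 fun r => polarInflection p q t (Z r) := by
  have h2 : IsTrigPoly 1 fun r => q - t * Z r :=
    ((IsTrigPoly.const q).mono zero_le_one).sub (hZ.const_mul t)
  have h3 : IsTrigPoly 1 fun r => 1 + Z r := ((IsTrigPoly.const 1).mono zero_le_one).add hZ
  have h4 := ((h2.const_mul (-1)).mul h3).mul (hZ.capDisc p q t)
  convert h4.add ((hZ.equatorialInflection p q t).const_mul (2 / 3)) using 2
  rw [_root_.polarInflection]; ring

/-- The zeros of a function, unless it vanishes identically. -/
def properZeros (f : ℝ → ℝ) : Set ℝ := {r | f r = 0 ∧ ∃ s, f s ≠ 0}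

theorem encard_properZeros_le {n : ℕ} {f : ℝ → ℝ} (hf : IsTrigPoly n f) (x : ℝ) :
    (properZeros f ∩ Set.Ico x (x + 2 * Real.pi)).encard ≤ (2 * n : ℕ) := by
  by_cases hne : ∃ s, f s ≠ 0
  · refine (Set.encard_le_encard ?_).trans (hf.encard_roots_le hne x)
    exact fun r hr => ⟨hr.1.1, hr.2⟩
  · have : properZeros f = ∅ := Set.eq_empty_of_forall_notMem fun r hr => hne hr.2
    simp [this]

/-- Discarding identically vanishing functions keeps the zero count finite and costs nothing,
because constant sign includes being zero throughout. -/
theorem hasConstSign_of_properZeros {f : ℝ → ℝ} (hf : Continuous f) {a b : ℝ}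
    (h : ∀ x ∈ properZeros f, x ∉ Set.Ioo a b) : HasConstSign f a b := by
  refine hasConstSign_of_ne_zero hf ?_
  by_cases hne : ∃ s, f s ≠ 0
  · exact Or.inr fun r hr h0 => h r ⟨h0, hne⟩ hr
  · push Not at hne
    exact Or.inl hne

theorem encard_biUnion_properZeros_le {ι : Type*} (s : Finset ι) {n : ι → ℕ} {f : ι → ℝ → ℝ}
    (hf : ∀ i ∈ s, IsTrigPoly (n i) (f i)) (x : ℝ) :
    ((⋃ i ∈ s, properZeros (f i)) ∩ Set.Ico x (x + 2 * Real.pi)).encard ≤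
      (∑ i ∈ s, 2 * n i : ℕ) := by
  classical
  induction s using Finset.induction_on with
  | empty => simp
  | insert i s hi ih =>
    rw [Finset.set_biUnion_insert, Set.union_inter_distrib_right, Finset.sum_insert hi]
    refine (Set.encard_union_le _ _).trans ?_
    push_cast
    refine add_le_add ?_ ?_
    · simpa using encard_properZeros_le (hf i (Finset.mem_insert_self i s)) x
    · simpa using ih fun j hj => hf j (Finset.mem_insert_of_mem hj)

theorem corollary5 :
    ∃ M : ℕ, ∀ (w : S2) (t : ℝ), t ∈ Set.Ioo (-1 : ℝ) 1 →
      -- the circle `∂C(w,t)` is run through once by `c`, and cut into `m ≤ M` arcs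
      ∃ (m : ℕ) (s : Fin (m + 1) → ℝ) (c : ℝ → S2),
        1 ≤ m ∧ m ≤ M ∧ StrictMono s ∧
        ContinuousOn c (Set.Icc (s 0) (s (Fin.last m))) ∧
        c (s 0) = c (s (Fin.last m)) ∧
        Set.BijOn c (Set.Ico (s 0) (s (Fin.last m))) (capBoundary w t) ∧
        -- the cuts are made only where the projected curve breaks
        -- (a curve without a break is a single closed piece)
        (m = 1 ∨ ∀ i, c (s i) ∈ breakPoints w t) ∧
        -- every piece is, with its end points added, an at most 36-convex curve
        ∀ i : Fin m, ∃ (n : ℕ) (β : ℝ → ℝ × ℝ), n ≤ 36 ∧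
          IsNConvex n (s i.castSucc) (s i.succ) β ∧
          ∀ r ∈ Set.Ioo (s i.castSucc) (s i.succ),
            c r ∉ poles ∧ healpixProj (c r) = β r := by
  refine ⟨36, fun w t ht => ?_⟩
  obtain ⟨p, q, u, v, hp, hpq, huv, hw0, hw1, hw2⟩ := exists_horizontal_frame w
  obtain ⟨ρ, c, hρ, hρt, hc, hper, hbij, hcoord⟩ :=
    exists_circle_param w ht hpq huv hw0 hw1 hw2
  have hc0 := fun r => (hcoord r).1
  have hc1 := fun r => (hcoord r).2.1
  have hc2 := fun r => (hcoord r).2.2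
  let f : Fin 8 → ℝ → ℝ := ![Real.sin, fun r => (c r : E3) 0, fun r => (c r : E3) 1,
    fun r => (c r : E3) 2 - 2 / 3, fun r => (c r : E3) 2 + 2 / 3,
    fun r => equatorialInflection p q t ((c r : E3) 2),
    fun r => polarInflection p q t ((c r : E3) 2),
    fun r => polarInflection p (-q) t (-(c r : E3) 2)]
  let n : Fin 8 → ℕ := ![1, 1, 1, 1, 1, 4, 4, 4]
  have hZ : IsTrigPoly 1 fun r => (c r : E3) 2 := by
    convert IsTrigPoly.affine (t * q) (ρ * p) 0 using 2
    rw [hc2]; ring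
  have hZ' : IsTrigPoly 1 fun r => -(c r : E3) 2 := by simpa using hZ.const_mul (-1)
  have hf : ∀ i, IsTrigPoly (n i) (f i) := by
    intro i
    fin_cases i
    · exact IsTrigPoly.sin
    · change IsTrigPoly 1 fun r => (c r : E3) 0
      convert IsTrigPoly.affine (u * (t * p)) (-(u * (ρ * q))) (-(v * ρ)) using 2
      rw [hc0]; ring
    · change IsTrigPoly 1 fun r => (c r : E3) 1
      convert IsTrigPoly.affine (v * (t * p)) (-(v * (ρ * q))) (u * ρ) using 2
      rw [hc1]; ring
    · exact hZ.sub ((IsTrigPoly.const (2 / 3)).mono zero_le_one)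
    · exact hZ.add ((IsTrigPoly.const (2 / 3)).mono zero_le_one)
    · exact hZ.equatorialInflection p q t
    · exact hZ.polarInflection p q t
    · exact hZ'.polarInflection p (-q) t
  have hcont : ∀ i, Continuous (f i) := by
    have k0 : Continuous fun r => (c r : E3) 0 := by fun_prop
    have k1 : Continuous fun r => (c r : E3) 1 := by fun_prop
    have k2 : Continuous fun r => (c r : E3) 2 := by fun_prop
    have kE : Continuous (equatorialInflection p q t) := by
      unfold equatorialInflection capDisc; fun_prop
    have kP (q : ℝ) : Continuous (polarInflection p q t) := by
      unfold polarInflection equatorialInflection capDisc; fun_prop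
    intro i
    fin_cases i
    · exact Real.continuous_sin
    · exact k0
    · exact k1
    · exact k2.sub continuous_const
    · exact k2.add continuous_const
    · exact kE.comp k2
    · exact (kP q).comp k2
    · exact (kP (-q)).comp k2.neg
  refine exists_nConvex_pieces hc hper hbij (T := ⋃ i ∈ Finset.univ, properZeros (f i)) ?_ ?_ ?_ ?_
  · simp only [Set.mem_iUnion]
    exact ⟨0, Finset.mem_univ _, Real.sin_zero, Real.pi / 2, by simp [f]⟩
  · simp only [Set.mem_iUnion]
    rintro r ⟨i, hi, h0, hs⟩
    exact ⟨i, hi, by rw [(hf i).periodic]; exact h0, hs⟩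
  · intro x
    refine (encard_biUnion_properZeros_le _ (fun i _ => hf i) x).trans ?_
    -- The sum is `2 (5 · 1 + 3 · 4) = 34`.
    have : ∑ i, 2 * n i ≤ 36 := by decide
    exact_mod_cast this
  · intro a b hab hT
    have hsign (i : Fin 8) : HasConstSign (f i) a b :=
      hasConstSign_of_properZeros (hcont i) fun x hx =>
        hT x (Set.mem_biUnion (Finset.mem_coe.2 (Finset.mem_univ i)) hx)
    rcases eq_or_lt_of_le hp with hp0 | hp0
    · subst hp0
      refine isConvexGap_of_parallel (q := q) (u := u) (v := v) (t := t) (by linarith) huv hρ hc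
        (fun r => ?_) (fun r => ?_) (fun r => ?_) (hsign 1) (hsign 2)
      · rw [hc0]; ring
      · rw [hc1]; ring
      · rw [hc2]; ring
    · refine isConvexGap_of_pos hp0 hpq huv hρ hρt hc hc0 hc1 hc2 hab ?_ (hsign 1) (hsign 2)
        (hsign 3) (hsign 4) (hsign 5) (hsign 6) (hsign 7)
      have hmid : (a + b) / 2 ∈ Set.Ioo a b := ⟨by linarith, by linarith⟩
      rcases hsign 0 with h | h | h
      · exact Or.inl h
      · exact Or.inr h
      · exfalso
        -- The sine is not identically zero, so vanishing on the gap would make its midpoint a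
        -- special parameter.
        have hsinz : ∀ r ∈ Set.Ioo a b, r ∈ properZeros Real.sin := fun r hr =>
          ⟨h r hr, Real.pi / 2, by simp⟩
        exact hT _ (Set.mem_biUnion (Finset.mem_coe.2 (Finset.mem_univ (0 : Fin 8)))
          (hsinz _ hmid)) hmid
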